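/- **Setting.** A sequence $(Z_i)_{i\ge1}$ of real random variables is *negatively associated (NA)* if for all disjoint finite index sets $A,B$ and all measurable functions $\varphi,\psi$ that are both coordinatewise increasing or both coordinatewise decreasing, $\operatorname{Cov}(\varphi(Z_i;i\in A),\psi(Z_j;j\in B))\le 0$ whenever this covariance exists. Let $(T_i)_{i\ge1}$ and $(Y_i)_{i\ge1}$ be NA sequences of nonnegative random variables on one probability space, the two sequences being independent of each other. All $T_i$ have the same continuous distribution function $F$, and all $Y_i$ have the same distribution function $G$. The observations are $X_i=\min(T_i,Y_i)$ and $\delta_i=I(T_i\le Y_i)$. Let $L$ be the distribution function of $X_1$, $\tau_L=\sup\{x:L(x)<1\}\in(0,\infty]$ and $a_F=\inf\{x:F(x)>0\}$. Put $N_n(t)=\sum_{i\le n}I(X_i\le t,\delta_i=1)$, $Y_n(t)=\sum_{i\le n}I(X_i\ge t)$, and let $\hat F_n$ be the Kaplan–Meier estimator, $$1-\hat F_n(t)=\prod_{s\le t}\Bigl(1-\frac{N_n(s)-N_n(s-)}{Y_n(s)}\Bigr),$$ where the product runs over the observed values $s\le t$. Let $k$ be a probability density on $\mathbb R$ that vanishes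 outside a finite interval $(r,s)$ with $r<0<s$ and is of bounded variation on it, and let $b_n>0$ with $b_n\to0$. Define $$f_n(t)=b_n^{-1}\int_{a_F}^\infty k\Bigl(\frac{t-x}{b_n}\Bigr)d\hat F_n(x),\quad \bar f_n(t)=b_n^{-1}\int_{a_F}^\infty k\Bigl(\frac{t-x}{b_n}\Bigr)dF(x),\quad f_n^*(t)=b_n^{-1}\int_{a_F}^\infty k\Bigl(\frac{t-x}{b_n}\Bigr)dF_{*n}(x),$$ where $F_{*n}(x)=\frac1n\sum_{i\le n}I(X_i\le x,\delta_i=1)$. **Theorem 1.** Let $a_F<\tau<\tau_L$, and suppose that on $[0,\tau]$ the functions $F$ and $G$ have densities $f$ and $g$ that are bounded there. If $b_n^{-1}=o\bigl((n/\ln n)^{1/2}\bigr)$, then almost surely $$\sup_{0<t\le\tau}\left|f_n(t)-\bar f_n(t)-\frac{f_n^*(t)-E f_n^*(t)}{1-G(t)}\right|=O\bigl(b_n^{-1}(\ln n/n)^{1/2}\bigr)\qquad(n\to\infty),$$ where the implied constant may depend on the realization. The same holds if $F_{*n}$ in the definition of $f_n^*$ is replaced by the empirical distribution function $\frac1n\sum_{i\le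 n}I(T_i\le x)$ of the lifetimes. -/

import Mathlib

open MeasureTheory ProbabilityTheory Set Filter Topology Asymptotics

noncomputable section

namespace CensoredNA

/-- A sequence of real random variables is negatively associated: for disjoint finite index sets
`A`, `B` and functions `φ`, `ψ` that are both coordinatewise increasing or both coordinatewise
decreasing, `φ (Z i, i ∈ A)` and `ψ (Z j, j ∈ B)` have nonpositive covariance whenever that
covariance exists. -/
def NegAssociated {Ω : Type*} [MeasurableSpace Ω] (μ : Measure Ω) (Z : ℕ → Ω → ℝ) : Prop :=
  ∀ (A B : Finset ℕ), Disjoint A B →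
    ∀ (φ : (A → ℝ) → ℝ) (ψ : (B → ℝ) → ℝ), Measurable φ → Measurable ψ →
      ((Monotone φ ∧ Monotone ψ) ∨ (Antitone φ ∧ Antitone ψ)) →
      Integrable (fun ω => φ (fun i => Z i ω)) μ →
      Integrable (fun ω => ψ (fun j => Z j ω)) μ →
      Integrable (fun ω => φ (fun i => Z i ω) * ψ (fun j => Z j ω)) μ →
      cov[fun ω => φ (fun i => Z i ω), fun ω => ψ (fun j => Z j ω); μ] ≤ 0

/-- Left endpoint `a_H = inf {x : H x > 0}` of a distribution function of a nonnegative random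
variable. -/
def leftEndpoint (H : ℝ → ℝ) : ℝ := sInf {x : ℝ | 0 < H x}

/-- Right endpoint `τ_H = sup {x : H x < 1}`, possibly `+∞`. -/
def rightEndpoint (H : ℝ → ℝ) : EReal := sSup ((fun x : ℝ => (x : EReal)) '' {x : ℝ | H x < 1})

/-- On `[0, τ]` the function `H` has the density `h`, and `h` is bounded there. -/
def HasBoundedDensityOn (H h : ℝ → ℝ) (τ : ℝ) : Prop :=
  IntegrableOn h (Icc 0 τ) ∧ (∀ x ∈ Icc 0 τ, H x - H 0 = ∫ u in (0 : ℝ)..x, h u) ∧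
    ∃ M : ℝ, ∀ x ∈ Icc 0 τ, |h x| ≤ M

/-- A bounded variation probability density on the finite interval `(r, s)`. -/
def IsBVKernel (k : ℝ → ℝ) (r s : ℝ) : Prop :=
  (∀ u, 0 ≤ k u) ∧ (∀ u, u ∉ Ioo r s → k u = 0) ∧ (∫ u, k u) = 1 ∧
    BoundedVariationOn k (Ioo r s)

section Estimators

open Classical in
/-- `Y_n(s)`: the number of the first `n` observations `x k` that are at least `s`. -/
def atRisk (n : ℕ) (x : ℕ → ℝ) (s : ℝ) : ℕ := ((Finset.range n).filter fun k => s ≤ x k).card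

open Classical in
/-- `N_n(s)`: the number of the first `n` observations that are at most `s` and uncensored
(`δ k` says that the observation `x k` is uncensored). -/
def events (n : ℕ) (x : ℕ → ℝ) (δ : ℕ → Prop) (s : ℝ) : ℕ :=
  ((Finset.range n).filter fun k => x k ≤ s ∧ δ k).card

open Classical in
/-- The jump `dN_n(s) = N_n(s) - N_n(s-)`: the number of uncensored observations equal to `s`. -/
def eventJump (n : ℕ) (x : ℕ → ℝ) (δ : ℕ → Prop) (s : ℝ) : ℕ :=
  ((Finset.range n).filter fun k => x k = s ∧ δ k).card

open Classical in
/-- The Kaplan-Meier survival estimate `∏_{s ≤ t} (1 - dN_n(s) / Y_n(s))`; the product runs over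
the distinct observed values, all other factors being `1`. -/
def kmSurv (n : ℕ) (x : ℕ → ℝ) (δ : ℕ → Prop) (t : ℝ) : ℝ :=
  ∏ s ∈ ((Finset.range n).image x).filter (fun s => s ≤ t),
    (1 - (eventJump n x δ s : ℝ) / (atRisk n x s : ℝ))

lemma filter_le_eventually_eq (S : Finset ℝ) (a : ℝ) :
    ∀ᶠ t in 𝓝[≥] a, ∀ s ∈ S, (s ≤ t ↔ s ≤ a) := by
  rw [Filter.eventually_all_finset]
  intro s _
  by_cases h : s ≤ a
  · filter_upwards [self_mem_nhdsWithin] with t ht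
    exact ⟨fun _ => h, fun _ => h.trans ht⟩
  · have h' : a < s := not_le.mp h
    filter_upwards [mem_nhdsWithin_of_mem_nhds (Iio_mem_nhds h')] with t ht
    exact ⟨fun h2 => absurd h2 (not_le.mpr ht), fun h2 => absurd h2 h⟩

lemma kmFactor_mem (n : ℕ) (x : ℕ → ℝ) (δ : ℕ → Prop) (s : ℝ) :
    0 ≤ 1 - (eventJump n x δ s : ℝ) / (atRisk n x s : ℝ) ∧
      1 - (eventJump n x δ s : ℝ) / (atRisk n x s : ℝ) ≤ 1 := by
  classical
  have h : (eventJump n x δ s : ℝ) ≤ (atRisk n x s : ℝ) := by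
    unfold eventJump atRisk
    refine Nat.cast_le.mpr (Finset.card_le_card fun k hk => ?_)
    rw [Finset.mem_filter] at hk ⊢
    exact ⟨hk.1, hk.2.1.ge⟩
  have h0 : (0 : ℝ) ≤ (eventJump n x δ s : ℝ) / (atRisk n x s : ℝ) := by positivity
  have h1 := div_le_one_of_le₀ h (Nat.cast_nonneg _)
  constructor <;> linarith

/-- The Kaplan-Meier estimator `F̂_n`. -/
def kmCDF (n : ℕ) (x : ℕ → ℝ) (δ : ℕ → Prop) : StieltjesFunction ℝ where
  toFun t := 1 - kmSurv n x δ t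
  mono' := by
    classical
    intro t t' htt
    have : kmSurv n x δ t' ≤ kmSurv n x δ t := by
      unfold kmSurv
      have hsub : ((Finset.range n).image x).filter (fun s => s ≤ t) ⊆
          ((Finset.range n).image x).filter (fun s => s ≤ t') := fun s hs => by
        rw [Finset.mem_filter] at hs ⊢
        exact ⟨hs.1, hs.2.trans htt⟩
      rw [← Finset.prod_sdiff hsub]
      exact mul_le_of_le_one_left
        (Finset.prod_nonneg fun s _ => (kmFactor_mem n x δ s).1)
        (Finset.prod_le_one (fun s _ => (kmFactor_mem n x δ s).1)
          fun s _ => (kmFactor_mem n x δ s).2)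
    exact sub_le_sub_left this 1
  right_continuous' a := by
    classical
    refine ContinuousWithinAt.congr_of_eventuallyEq
      (f := fun _ => 1 - kmSurv n x δ a) continuousWithinAt_const ?_ rfl
    filter_upwards [filter_le_eventually_eq ((Finset.range n).image x) a] with t ht
    unfold kmSurv
    congr 2
    ext s
    simp only [Finset.mem_filter]
    exact and_congr_right fun hs => ht s hs

/-- The empirical (sub-)distribution function `t ↦ (1/n) #{k : x k ≤ t, δ k}` of the first `n`
observations. -/
def empCDF (n : ℕ) (x : ℕ → ℝ) (δ : ℕ → Prop) : StieltjesFunction ℝ where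
  toFun t := (1 / (n : ℝ)) * (events n x δ t : ℝ)
  mono' := by
    classical
    intro t t' htt
    have : events n x δ t ≤ events n x δ t' := by
      unfold events
      exact Finset.card_le_card
        (Finset.monotone_filter_right _ fun k _ hk => ⟨hk.1.trans htt, hk.2⟩)
    have h2 : (events n x δ t : ℝ) ≤ (events n x δ t' : ℝ) := by exact_mod_cast this
    exact mul_le_mul_of_nonneg_left h2 (by positivity)
  right_continuous' a := by
    classical
    refine ContinuousWithinAt.congr_of_eventuallyEq
      (f := fun _ => (1 / (n : ℝ)) * (events n x δ a : ℝ)) continuousWithinAt_const ?_ rfl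
    filter_upwards [filter_le_eventually_eq ((Finset.range n).image x) a] with t ht
    have : events n x δ t = events n x δ a := by
      unfold events
      congr 1
      ext k
      simp only [Finset.mem_filter]
      refine and_congr_right fun hk => and_congr_left fun _ => ?_
      exact ht (x k) (Finset.mem_image_of_mem x hk)
    simp only [this]

/-- `b⁻¹ ∫_a^∞ k((t - x)/b) dH(x)`. -/
def kernelSmooth (k : ℝ → ℝ) (b a : ℝ) (H : StieltjesFunction ℝ) (t : ℝ) : ℝ :=
  b⁻¹ * ∫ x in Ici a, k ((t - x) / b) ∂H.measure

end Estimators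

section Model

variable {Ω : Type*}

/-- The observed times `X_i = min (T_i, Y_i)`. -/
def obs (T Y : ℕ → Ω → ℝ) (i : ℕ) (ω : Ω) : ℝ := min (T i ω) (Y i ω)

/-- The event `δ_i = 1`, that is, `T_i ≤ Y_i`. -/
def uncensored (T Y : ℕ → Ω → ℝ) (i : ℕ) (ω : Ω) : Prop := T i ω ≤ Y i ω

/-- `f_n(t) = b_n⁻¹ ∫_{a_F}^∞ k((t - x)/b_n) dF̂_n(x)`. -/
def fHat (k : ℝ → ℝ) (b : ℕ → ℝ) (F : StieltjesFunction ℝ) (T Y : ℕ → Ω → ℝ)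
    (n : ℕ) (t : ℝ) (ω : Ω) : ℝ :=
  kernelSmooth k (b n) (leftEndpoint F)
    (kmCDF n (fun i => obs T Y i ω) (fun i => uncensored T Y i ω)) t

/-- `f̄_n(t) = b_n⁻¹ ∫_{a_F}^∞ k((t - x)/b_n) dF(x)`. -/
def fBar (k : ℝ → ℝ) (b : ℕ → ℝ) (F : StieltjesFunction ℝ) (n : ℕ) (t : ℝ) : ℝ :=
  kernelSmooth k (b n) (leftEndpoint F) F t

/-- `f_n^*(t) = b_n⁻¹ ∫_{a_F}^∞ k((t - x)/b_n) dF_{*n}(x)`, where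
`F_{*n}(x) = (1/n) #{i : X_i ≤ x, δ_i = 1}`. -/
def fStar (k : ℝ → ℝ) (b : ℕ → ℝ) (F : StieltjesFunction ℝ) (T Y : ℕ → Ω → ℝ)
    (n : ℕ) (t : ℝ) (ω : Ω) : ℝ :=
  kernelSmooth k (b n) (leftEndpoint F)
    (empCDF n (fun i => obs T Y i ω) (fun i => uncensored T Y i ω)) t

/-- The same smoother applied to the empirical distribution function
`(1/n) #{i : T_i ≤ x}` of the lifetimes themselves. -/
def fStarLife (k : ℝ → ℝ) (b : ℕ → ℝ) (F : StieltjesFunction ℝ) (T : ℕ → Ω → ℝ)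
    (n : ℕ) (t : ℝ) (ω : Ω) : ℝ :=
  kernelSmooth k (b n) (leftEndpoint F) (empCDF n (fun i => T i ω) (fun _ => True)) t

end Model

end CensoredNA

end

/-! The rate `b⁻¹ (log n / n)^{1/2}` is already the size of the smoothed Kaplan-Meier error and of
the centred smoothed empirical function separately, so no cancellation between them is needed. Each
is bounded alone, and `1 - G t` stays away from `0` for `t ≤ τ` because `τ` lies strictly below the
right endpoint of the observations. The constant obtained is deterministic; only the index from
which the bound holds depends on the realization.

Smoothing: a kernel of bounded variation is a difference of two unimodal functions, whose superlevel
sets are intervals. By the layer-cake formula, integrals of the kernel against two measures differ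
by at most a constant times their Kolmogorov distance (`IsBVKernel.exists_abs_integral_sub_le`).
Only uniform bounds of order `rate n` on distribution functions remain to be proved.

Empirical functions: for an event that is monotone in the lifetime and monotone in the censoring
time, negative association is applied to the lifetimes with the censoring times frozen, then to the
censoring times. This bounds exponential moments as under independence
(`CensoredModel.hasSubgaussianMGF`). Hoeffding's inequality, Borel-Cantelli and a quantile grid give
uniformity (`CensoredModel.ae_eventually_uniform`).

Kaplan-Meier: the product is close to the exponential of minus the Nelson-Aalen sum, this sum is
close to the cumulative hazard, and for a continuous law the exponential of minus the cumulative
hazard is the survival function (`abs_kmSurv_sub_le`). -/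

namespace CensoredNA

/-! ### Kernel integrals and Kolmogorov distance -/

section Kolmogorov

variable {μ ν : Measure ℝ} [IsFiniteMeasure μ] [IsFiniteMeasure ν] {c ε : ℝ}

theorem tendsto_real_Iic_Iio (μ : Measure ℝ) [IsFiniteMeasure μ] {a : ℝ} {u : ℕ → ℝ}
    (hu : StrictMono u) (hlt : ∀ n, u n < a) (hlim : Tendsto u atTop (𝓝 a)) :
    Tendsto (fun n => μ.real (Iic (u n))) atTop (𝓝 (μ.real (Iio a))) := by
  have h := tendsto_measure_iUnion_atTop (μ := μ) (s := fun n => Iic (u n))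
    (fun i j hij => Iic_subset_Iic.2 (hu.monotone hij))
  rw [iUnion_Iic_eq_Iio_of_lt_of_tendsto hlt hlim] at h
  exact (ENNReal.tendsto_toReal (measure_ne_top _ _)).comp h

theorem abs_real_Iio_sub_le (h : ∀ x ≤ c, |μ.real (Iic x) - ν.real (Iic x)| ≤ ε) {a : ℝ}
    (ha : a ≤ c) : |μ.real (Iio a) - ν.real (Iio a)| ≤ ε := by
  obtain ⟨u, hu, hlt, hlim⟩ := exists_seq_strictMono_tendsto a
  refine le_of_tendsto
    ((tendsto_real_Iic_Iio μ hu hlt hlim).sub (tendsto_real_Iic_Iio ν hu hlt hlim)).abs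
    (Eventually.of_forall fun n => h _ ((hlt n).le.trans ha))

theorem eq_Iic_or_Iio_of_isLowerSet {D : Set ℝ} (hD : IsLowerSet D) (hne : D.Nonempty)
    (hb : BddAbove D) : D = Iic (sSup D) ∨ D = Iio (sSup D) := by
  by_cases hm : sSup D ∈ D
  · left
    ext x
    exact ⟨fun hx => le_csSup hb hx, fun hx => hD hx hm⟩
  · right
    ext x
    refine ⟨fun hx => lt_of_le_of_ne (le_csSup hb hx) (fun h => hm (h ▸ hx)), fun hx => ?_⟩
    obtain ⟨y, hy, hxy⟩ := exists_lt_of_lt_csSup hne hx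
    exact hD hxy.le hy

theorem abs_real_lowerSet_sub_le (hε : 0 ≤ ε)
    (h : ∀ x ≤ c, |μ.real (Iic x) - ν.real (Iic x)| ≤ ε) {D : Set ℝ} (hD : IsLowerSet D)
    (hDc : D ⊆ Iic c) : |μ.real D - ν.real D| ≤ ε := by
  rcases D.eq_empty_or_nonempty with rfl | hne
  · simpa using hε
  have hb : BddAbove D := ⟨c, fun x hx => hDc hx⟩
  have hs : sSup D ≤ c := csSup_le hne fun x hx => hDc hx
  rcases eq_Iic_or_Iio_of_isLowerSet hD hne hb with hE | hE
  · rw [hE]; exact h _ hs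
  · rw [hE]; exact abs_real_Iio_sub_le h hs

/-- An interval is a difference of two nested lower sets, each costing one `ε`. Closeness is assumed
only up to `c`, since the Kaplan-Meier estimator is controlled only where enough subjects remain at
risk. -/
theorem abs_real_ordConnected_sub_le (hε : 0 ≤ ε)
    (h : ∀ x ≤ c, |μ.real (Iic x) - ν.real (Iic x)| ≤ ε) {S : Set ℝ} (hS : S.OrdConnected)
    (hSc : S ⊆ Iic c) : |μ.real S - ν.real S| ≤ 2 * ε := by
  rcases S.eq_empty_or_nonempty with rfl | ⟨z, hz⟩
  · simpa using hε
  set A : Set ℝ := {x | ∃ y ∈ S, x ≤ y} with hA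
  set B : Set ℝ := {x | ∀ y ∈ S, x < y} with hB
  have hAl : IsLowerSet A := fun x y hyx ⟨w, hw, hxw⟩ => ⟨w, hw, hyx.trans hxw⟩
  have hBl : IsLowerSet B := fun x y hyx hx w hw => hyx.trans_lt (hx w hw)
  have hAc : A ⊆ Iic c := fun x ⟨y, hy, hxy⟩ => hxy.trans (hSc hy)
  have hBA : B ⊆ A := fun x hx => ⟨z, hz, (hx z hz).le⟩
  have hSAB : S = A \ B := by
    ext x
    refine ⟨fun hx => ⟨⟨x, hx, le_rfl⟩, fun hxB => lt_irrefl _ (hxB x hx)⟩, ?_⟩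
    rintro ⟨⟨y, hy, hxy⟩, hxB⟩
    simp only [hB, mem_ofPred_eq, not_forall, not_lt] at hxB
    obtain ⟨w, hw, hwx⟩ := hxB
    exact hS.out hw hy ⟨hwx, hxy⟩
  have hBm : MeasurableSet B := hBl.ordConnected.measurableSet
  have h1 := abs_real_lowerSet_sub_le hε h hAl hAc
  have h2 := abs_real_lowerSet_sub_le hε h hBl (hBA.trans hAc)
  rw [hSAB, measureReal_sdiff hBA hBm, measureReal_sdiff hBA hBm]
  rw [abs_le] at h1 h2 ⊢
  constructor <;> linarith [h1.1, h1.2, h2.1, h2.2]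

/-- A function with values in `[0, M]` that vanishes on `(c, ∞)` and is quasiconcave on its
support. -/
structure UnimodalLE (c M : ℝ) (φ : ℝ → ℝ) : Prop where
  nonneg : ∀ x, 0 ≤ φ x
  le : ∀ x, φ x ≤ M
  ordConnected : ∀ u, 0 < u → {x | u ≤ φ x}.OrdConnected
  eq_zero : ∀ x, c < x → φ x = 0

theorem UnimodalLE.measurable {c M : ℝ} {φ : ℝ → ℝ} (hφ : UnimodalLE c M φ) : Measurable φ := by
  refine measurable_of_Ici fun u => ?_
  rcases lt_or_ge 0 u with hu | hu
  · exact (hφ.ordConnected u hu).measurableSet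
  · have : φ ⁻¹' Ici u = univ := eq_univ_of_forall fun x => hu.trans (hφ.nonneg x)
    rw [this]; exact MeasurableSet.univ

theorem UnimodalLE.integrable {c M : ℝ} {φ : ℝ → ℝ} (hφ : UnimodalLE c M φ) (μ : Measure ℝ)
    [IsFiniteMeasure μ] : Integrable φ μ :=
  Integrable.of_bound hφ.measurable.aestronglyMeasurable M (Eventually.of_forall fun x => by
    rw [Real.norm_of_nonneg (hφ.nonneg x)]; exact hφ.le x)

/-- Layer cake: the integral is the integral over levels in `(0, M]` of the masses of superlevel
sets. These sets are intervals inside `(-∞, c]`, so each level contributes at most `2 * ε`. -/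
theorem UnimodalLE.abs_integral_sub_le {M : ℝ} {φ : ℝ → ℝ} (hφ : UnimodalLE c M φ) (hε : 0 ≤ ε)
    (h : ∀ x ≤ c, |μ.real (Iic x) - ν.real (Iic x)| ≤ ε) :
    |∫ x, φ x ∂μ - ∫ x, φ x ∂ν| ≤ 2 * ε * M := by
  have hM : 0 ≤ M := (hφ.nonneg 0).trans (hφ.le 0)
  have hlay : ∀ (ρ : Measure ℝ) [IsFiniteMeasure ρ],
      ∫ x, φ x ∂ρ = ∫ t in Ioc 0 M, ρ.real {a | t ≤ φ a} := fun ρ _ =>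
    (hφ.integrable ρ).integral_eq_integral_Ioc_meas_le (Eventually.of_forall hφ.nonneg)
      (Eventually.of_forall hφ.le)
  have hint : ∀ (ρ : Measure ℝ) [IsFiniteMeasure ρ],
      IntegrableOn (fun t => ρ.real {a | t ≤ φ a}) (Ioc 0 M) := fun ρ _ => by
    refine Integrable.of_bound ?_ (ρ.real univ) (Eventually.of_forall fun t => ?_)
    · refine (Antitone.measurable fun s t hst => ?_).aestronglyMeasurable
      exact measureReal_mono fun a (ha : t ≤ φ a) => hst.trans ha
    · rw [Real.norm_of_nonneg measureReal_nonneg]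
      exact measureReal_mono (subset_univ _)
  rw [hlay μ, hlay ν, ← integral_sub (hint μ) (hint ν), ← Real.norm_eq_abs]
  refine (norm_setIntegral_le_of_norm_le_const (C := 2 * ε) measure_Ioc_lt_top ?_).trans_eq ?_
  · intro t ht
    refine abs_real_ordConnected_sub_le hε h (hφ.ordConnected t ht.1) fun x hx => ?_
    by_contra hxc
    have := hφ.eq_zero x (not_le.1 hxc)
    have hx' : t ≤ φ x := hx
    linarith [ht.1]
  · simp [hM]

theorem UnimodalLE.indicator {c M : ℝ} {φ : ℝ → ℝ} (hφ : UnimodalLE c M φ) {J : Set ℝ}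
    (hJ : J.OrdConnected) : UnimodalLE c M (J.indicator φ) where
  nonneg x := indicator_nonneg (fun x _ => hφ.nonneg x) x
  le x := (indicator_le_self' (fun x _ => hφ.nonneg x) x).trans (hφ.le x)
  ordConnected u hu := by
    have : {x | u ≤ J.indicator φ x} = J ∩ {x | u ≤ φ x} := by
      ext x
      by_cases hx : x ∈ J <;> simp [hx, hu]
    rw [this]
    exact hJ.inter (hφ.ordConnected u hu)
  eq_zero x hx := by
    by_cases hxJ : x ∈ J <;> simp [hxJ, hφ.eq_zero x hx]

theorem unimodalLE_indicator_of_monotoneOn {c M : ℝ} {φ : ℝ → ℝ} {J : Set ℝ}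
    (hJ : J.OrdConnected) (hJc : J ⊆ Iic c) (hmono : MonotoneOn φ J) (h0 : ∀ x ∈ J, 0 ≤ φ x)
    (hM0 : 0 ≤ M) (hM : ∀ x ∈ J, φ x ≤ M) : UnimodalLE c M (J.indicator φ) where
  nonneg x := indicator_nonneg h0 x
  le x := by
    by_cases hx : x ∈ J <;> simp [hx, hM0, hM]
  ordConnected u hu := by
    refine ⟨fun x hx y hy z hz => ?_⟩
    have hxJ : x ∈ J := by
      by_contra hn
      simp only [mem_ofPred_eq, indicator_of_notMem hn] at hx
      linarith
    have hyJ : y ∈ J := by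
      by_contra hn
      simp only [mem_ofPred_eq, indicator_of_notMem hn] at hy
      linarith
    have hzJ : z ∈ J := hJ.out hxJ hyJ hz
    simp only [mem_ofPred_eq, indicator_of_mem hxJ, indicator_of_mem hzJ] at hx ⊢
    exact hx.trans (hmono hxJ hzJ hz.1)
  eq_zero x hx := indicator_of_notMem (fun h => (not_le.2 hx) (hJc h)) _

/-- The reflection in `x ↦ (t - x) / b` exchanges the ends of the support, so vanishing to the left
of `r` becomes vanishing to the right of `t - r * b`. As `r < 0` for the kernel, this endpoint lies
beyond `t`. -/
theorem UnimodalLE.comp_affine {c M : ℝ} {φ : ℝ → ℝ} {r : ℝ} (hφ : UnimodalLE c M φ)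
    (hr : ∀ x, x ≤ r → φ x = 0) {b t : ℝ} (hb : 0 < b) :
    UnimodalLE (t - r * b) M (fun x => φ ((t - x) / b)) where
  nonneg x := hφ.nonneg _
  le x := hφ.le _
  ordConnected u hu := by
    have : {x | u ≤ φ ((t - x) / b)} = (fun x => (t - x) / b) ⁻¹' {x | u ≤ φ x} := rfl
    rw [this]
    refine (hφ.ordConnected u hu).preimage_anti fun x y hxy => ?_
    exact div_le_div_of_nonneg_right (by linarith) hb.le
  eq_zero x hx := hr _ (by
    rw [div_le_iff₀ hb]; linarith)

/-- A kernel of bounded variation is a difference of two unimodal functions. -/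
theorem IsBVKernel.exists_unimodalLE {k : ℝ → ℝ} {r s : ℝ} (hr : r < 0) (hs : 0 < s)
    (hk : IsBVKernel k r s) : ∃ (p q : ℝ → ℝ) (M : ℝ), UnimodalLE s M p ∧ UnimodalLE s M q ∧
      (∀ x, x ≤ r → p x = 0) ∧ (∀ x, x ≤ r → q x = 0) ∧ ∀ x, k x = p x - q x := by
  obtain ⟨hk0, hkz, -, hbv⟩ := hk
  have h0 : (0 : ℝ) ∈ Ioo r s := ⟨hr, hs⟩
  have hloc := hbv.locallyBoundedVariationOn
  set V : ℝ := (eVariationOn k (Ioo r s)).toReal with hV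
  set v : ℝ → ℝ := variationOnFromTo k (Ioo r s) 0 with hv
  have hvabs : ∀ x, |v x| ≤ V := fun x => variationOnFromTo.abs_le_eVariationOn hbv
  have hV0 : 0 ≤ V := ENNReal.toReal_nonneg
  have hkb : ∀ x ∈ Ioo r s, k x ≤ k 0 + V := fun x hx => by
    have := hbv.sub_le hx h0
    linarith
  -- Jordan decomposition `k = v - (v - k)`. Since `v ≥ -V` and `k ≤ k 0 + V`, the common shift `2 *
  -- V + k 0` makes both parts nonnegative, and `3 * V + k 0` bounds both.
  have hp : MonotoneOn (fun x => v x + (2 * V + k 0)) (Ioo r s) := fun x hx y hy hxy => by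
    have := variationOnFromTo.monotoneOn hloc h0 hx hy hxy
    simp only [hv]; linarith
  have hq : MonotoneOn (fun x => v x - k x + (2 * V + k 0)) (Ioo r s) := fun x hx y hy hxy => by
    have := variationOnFromTo.sub_self_monotoneOn hloc h0 hx hy hxy
    simp only [hv, Pi.sub_apply] at this ⊢; linarith
  have hsub : Ioo r s ⊆ Iic s := fun x hx => hx.2.le
  refine ⟨(Ioo r s).indicator fun x => v x + (2 * V + k 0),
    (Ioo r s).indicator fun x => v x - k x + (2 * V + k 0), 3 * V + k 0,
    unimodalLE_indicator_of_monotoneOn ordConnected_Ioo hsub hp ?_ ?_ ?_,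
    unimodalLE_indicator_of_monotoneOn ordConnected_Ioo hsub hq ?_ ?_ ?_, ?_, ?_, ?_⟩
  · intro x _; have := abs_le.1 (hvabs x); have := hk0 0; linarith
  · have := hk0 0; linarith
  · intro x _; have := abs_le.1 (hvabs x); linarith
  · intro x hx; have := abs_le.1 (hvabs x); have := hkb x hx; linarith
  · have := hk0 0; linarith
  · intro x _; have := abs_le.1 (hvabs x); have := hk0 x; linarith
  · intro x hx; exact indicator_of_notMem (fun h => not_lt.2 hx h.1) _
  · intro x hx; exact indicator_of_notMem (fun h => not_lt.2 hx h.1) _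
  · intro x
    by_cases hx : x ∈ Ioo r s
    · simp only [indicator_of_mem hx]; ring
    · simp [indicator_of_notMem hx, hkz x hx]

theorem IsBVKernel.measurable {k : ℝ → ℝ} {r s : ℝ} (hr : r < 0) (hs : 0 < s)
    (hk : IsBVKernel k r s) : Measurable k := by
  obtain ⟨p, q, M, hp, hq, -, -, hkpq⟩ := hk.exists_unimodalLE hr hs
  rw [funext hkpq]
  exact hp.measurable.sub hq.measurable

theorem IsBVKernel.exists_bound {k : ℝ → ℝ} {r s : ℝ} (hr : r < 0) (hs : 0 < s)
    (hk : IsBVKernel k r s) : ∃ M, ∀ x, |k x| ≤ M := by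
  obtain ⟨p, q, M, hp, hq, -, -, hkpq⟩ := hk.exists_unimodalLE hr hs
  refine ⟨M, fun x => ?_⟩
  rw [hkpq, abs_le]
  constructor <;> linarith [hp.nonneg x, hp.le x, hq.nonneg x, hq.le x]

/-- Smoothing with a kernel of bounded variation is Lipschitz in the Kolmogorov distance. -/
theorem IsBVKernel.exists_abs_integral_sub_le {k : ℝ → ℝ} {r s : ℝ} (hr : r < 0) (hs : 0 < s)
    (hk : IsBVKernel k r s) : ∃ K, 0 ≤ K ∧ ∀ (μ ν : Measure ℝ) [IsFiniteMeasure μ]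
      [IsFiniteMeasure ν] (c ε : ℝ), 0 ≤ ε → (∀ x ≤ c, |μ.real (Iic x) - ν.real (Iic x)| ≤ ε) →
      ∀ (a b t : ℝ), 0 < b → t - r * b ≤ c →
        |∫ x in Ici a, k ((t - x) / b) ∂μ - ∫ x in Ici a, k ((t - x) / b) ∂ν| ≤ K * ε := by
  obtain ⟨p, q, M, hp, hq, hpr, hqr, hkpq⟩ := hk.exists_unimodalLE hr hs
  have hM : 0 ≤ M := (hp.nonneg 0).trans (hp.le 0)
  -- Each of the two unimodal parts contributes `2 * ε * M`; cutting at `a` preserves unimodality.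
  refine ⟨4 * M, by positivity, fun μ ν _ _ c ε hε h a b t hb htc => ?_⟩
  have key : ∀ φ, UnimodalLE s M φ → (∀ x, x ≤ r → φ x = 0) →
      |∫ x in Ici a, φ ((t - x) / b) ∂μ - ∫ x in Ici a, φ ((t - x) / b) ∂ν| ≤ 2 * ε * M ∧
      (∀ (ρ : Measure ℝ) [IsFiniteMeasure ρ],
        Integrable (fun x => φ ((t - x) / b)) (ρ.restrict (Ici a))) := by
    intro φ hφ hφr
    have h1 := hφ.comp_affine hφr (t := t) hb
    have h2 := h1.indicator (J := Ici a) ordConnected_Ici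
    refine ⟨?_, fun ρ _ => h1.integrable _⟩
    rw [← integral_indicator measurableSet_Ici, ← integral_indicator measurableSet_Ici]
    exact h2.abs_integral_sub_le hε fun x hx => h x (hx.trans htc)
  obtain ⟨hp1, hp2⟩ := key p hp hpr
  obtain ⟨hq1, hq2⟩ := key q hq hqr
  simp only [hkpq]
  rw [integral_sub (hp2 μ) (hq2 μ), integral_sub (hp2 ν) (hq2 ν)]
  rw [abs_le] at hp1 hq1 ⊢
  constructor <;> linarith [hp1.1, hp1.2, hq1.1, hq1.2]

end Kolmogorov

/-! ### Exponential inequalities under negative association -/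

section NegativeAssociation

variable {Ω : Type*} [MeasurableSpace Ω] {μ : Measure Ω} [IsProbabilityMeasure μ]

theorem measurable_of_all_monotone_or_antitone {f : ℕ → ℝ → ℝ}
    (hf : (∀ i, Monotone (f i)) ∨ ∀ i, Antitone (f i)) (i : ℕ) : Measurable (f i) :=
  hf.elim (fun h => (h i).measurable) fun h => (h i).measurable

/-- Induction on `n`: a product of nonnegative functions monotone in one common direction is
monotone in that direction, so the first `n` factors and the next one have nonpositive covariance.
Boundedness ensures that the covariance exists. -/
theorem NegAssociated.integral_prod_le {Z : ℕ → Ω → ℝ} (hZ : NegAssociated μ Z)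
    (hmeas : ∀ i, Measurable (Z i)) {f : ℕ → ℝ → ℝ} {C : ℝ} (h0 : ∀ i x, 0 ≤ f i x)
    (hC : ∀ i x, f i x ≤ C) (hf : (∀ i, Monotone (f i)) ∨ ∀ i, Antitone (f i)) (n : ℕ) :
    ∫ ω, ∏ i ∈ Finset.range n, f i (Z i ω) ∂μ ≤ ∏ i ∈ Finset.range n, ∫ ω, f i (Z i ω) ∂μ := by
  have hfm := measurable_of_all_monotone_or_antitone hf
  induction n with
  | zero => simp
  | succ n ih =>
    set φ : (Finset.range n → ℝ) → ℝ := fun z => ∏ i : Finset.range n, f i (z i) with hφ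
    set ψ : (({n} : Finset ℕ) → ℝ) → ℝ := fun z => f n (z ⟨n, Finset.mem_singleton_self n⟩) with hψ
    have hφeq : ∀ ω, φ (fun i => Z i ω) = ∏ i ∈ Finset.range n, f i (Z i ω) := fun ω => by
      simp only [hφ]
      exact Finset.prod_coe_sort (Finset.range n) (fun i => f i (Z i ω))
    have hφm : Measurable φ := by
      simp only [hφ]
      exact Finset.measurable_prod _ fun i _ => (hfm i).comp (measurable_pi_apply i)
    have hψm : Measurable ψ := (hfm n).comp (measurable_pi_apply _)
    have hdir : (Monotone φ ∧ Monotone ψ) ∨ (Antitone φ ∧ Antitone ψ) := by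
      rcases hf with hf | hf
      · exact Or.inl ⟨fun x y hxy => Finset.prod_le_prod (fun i _ => h0 _ _)
          fun i _ => hf _ (hxy i), fun x y hxy => hf n (hxy _)⟩
      · exact Or.inr ⟨fun x y hxy => Finset.prod_le_prod (fun i _ => h0 _ _)
          fun i _ => hf _ (hxy i), fun x y hxy => hf n (hxy _)⟩
    have hX : MemLp (fun ω => ∏ i ∈ Finset.range n, f i (Z i ω)) 2 μ := by
      refine MemLp.of_bound (Finset.measurable_prod _ fun i _ =>
        (hfm i).comp (hmeas i)).aestronglyMeasurable (C ^ n) (Eventually.of_forall fun ω => ?_)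
      rw [Real.norm_of_nonneg (Finset.prod_nonneg fun i _ => h0 _ _)]
      refine (Finset.prod_le_prod (fun i _ => h0 _ _) fun i _ => hC i (Z i ω)).trans_eq ?_
      simp
    have hY : MemLp (fun ω => f n (Z n ω)) 2 μ := by
      refine MemLp.of_bound ((hfm n).comp (hmeas n)).aestronglyMeasurable C
        (Eventually.of_forall fun ω => ?_)
      rw [Real.norm_of_nonneg (h0 _ _)]
      exact hC _ _
    have hcov := hZ (Finset.range n) {n} (by simp) φ ψ hφm hψm hdir
      (by simpa only [hφeq] using hX.integrable one_le_two)
      (hY.integrable one_le_two)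
      (by simp only [hφeq, hψ]; exact hX.integrable_mul hY)
    simp only [hφeq, hψ] at hcov
    rw [covariance_eq_sub hX hY] at hcov
    simp only [Finset.prod_range_succ]
    have h1 : ∫ ω, (∏ i ∈ Finset.range n, f i (Z i ω)) * f n (Z n ω) ∂μ ≤
        (∫ ω, ∏ i ∈ Finset.range n, f i (Z i ω) ∂μ) * ∫ ω, f n (Z n ω) ∂μ := by
      have := hcov
      simp only [Pi.mul_apply] at this
      linarith
    exact h1.trans (mul_le_mul_of_nonneg_right ih (integral_nonneg fun ω => h0 _ _))

/-- Negatively associated lifetimes `T` with common law `P`, independent of negatively associated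
censoring times `Y` with common law `Q`. -/
structure CensoredModel (μ : Measure Ω) (T Y : ℕ → Ω → ℝ) (P Q : Measure ℝ) : Prop where
  measurable_T : ∀ i, Measurable (T i)
  measurable_Y : ∀ i, Measurable (Y i)
  negAssociated_T : NegAssociated μ T
  negAssociated_Y : NegAssociated μ Y
  indep : IndepFun (fun ω i => T i ω) (fun ω i => Y i ω) μ
  law_T : ∀ i, μ.map (T i) = P
  law_Y : ∀ i, μ.map (Y i) = Q

variable {T Y : ℕ → Ω → ℝ} {P Q : Measure ℝ}

theorem CensoredModel.isProbabilityMeasure_left (h : CensoredModel μ T Y P Q) :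
    IsProbabilityMeasure P :=
  h.law_T 0 ▸ Measure.isProbabilityMeasure_map (h.measurable_T 0).aemeasurable

theorem CensoredModel.isProbabilityMeasure_right (h : CensoredModel μ T Y P Q) :
    IsProbabilityMeasure Q :=
  h.law_Y 0 ▸ Measure.isProbabilityMeasure_map (h.measurable_Y 0).aemeasurable

theorem CensoredModel.law_pair (h : CensoredModel μ T Y P Q) (i : ℕ) :
    μ.map (fun ω => (T i ω, Y i ω)) = P.prod Q := by
  have hi : IndepFun (T i) (Y i) μ :=
    h.indep.comp (measurable_pi_apply i) (measurable_pi_apply i)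
  rw [(indepFun_iff_map_prod_eq_prod_map_map (h.measurable_T i).aemeasurable
    (h.measurable_Y i).aemeasurable).1 hi, h.law_T, h.law_Y]

/-- By independence, the lifetimes can be integrated first with the censoring times frozen. The
frozen factors vary with `i` but are all monotone in one direction, and their means `m (y i)` are
again monotone in `y i`, so negative association applies a second time. The directions in `t` and in
`y` may differ. -/
theorem CensoredModel.integral_prod_le (h : CensoredModel μ T Y P Q) {H : ℝ × ℝ → ℝ} {C : ℝ}
    (hm : Measurable H) (h0 : ∀ z, 0 ≤ H z) (hC : ∀ z, H z ≤ C)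
    (hT : (∀ y, Monotone fun t => H (t, y)) ∨ ∀ y, Antitone fun t => H (t, y))
    (hY : (∀ t, Monotone fun y => H (t, y)) ∨ ∀ t, Antitone fun y => H (t, y)) (n : ℕ) :
    ∫ ω, ∏ i ∈ Finset.range n, H (T i ω, Y i ω) ∂μ ≤ (∫ z, H z ∂(P.prod Q)) ^ n := by
  have := h.isProbabilityMeasure_left
  have := h.isProbabilityMeasure_right
  have hTm : Measurable fun ω i => T i ω := measurable_pi_lambda _ h.measurable_T
  have hYm : Measurable fun ω i => Y i ω := measurable_pi_lambda _ h.measurable_Y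
  have hPT := Measure.isProbabilityMeasure_map (μ := μ) hTm.aemeasurable
  have hPY := Measure.isProbabilityMeasure_map (μ := μ) hYm.aemeasurable
  have hlaw := (indepFun_iff_map_prod_eq_prod_map_map hTm.aemeasurable hYm.aemeasurable).1 h.indep
  set K : (ℕ → ℝ) × (ℕ → ℝ) → ℝ := fun z => ∏ i ∈ Finset.range n, H (z.1 i, z.2 i) with hK
  have hKm : Measurable K := Finset.measurable_prod _ fun i _ => hm.comp (by fun_prop)
  have hKint : Integrable K ((μ.map fun ω i => T i ω).prod (μ.map fun ω i => Y i ω)) := by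
    refine Integrable.of_bound hKm.aestronglyMeasurable (C ^ n) (Eventually.of_forall fun z => ?_)
    rw [Real.norm_of_nonneg (Finset.prod_nonneg fun i _ => h0 _)]
    refine (Finset.prod_le_prod (fun i _ => h0 _) fun i _ => hC _).trans_eq ?_
    simp
  set m : ℝ → ℝ := fun y => ∫ t, H (t, y) ∂P with hmdef
  have hHint : ∀ y, Integrable (fun t => H (t, y)) P := fun y =>
    Integrable.of_bound (hm.comp (by fun_prop)).aestronglyMeasurable C
      (Eventually.of_forall fun t => by rw [Real.norm_of_nonneg (h0 _)]; exact hC _)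
  have hm0 : ∀ y, 0 ≤ m y := fun y => integral_nonneg fun t => h0 _
  have hmC : ∀ y, m y ≤ C := fun y => by
    refine (integral_mono (hHint y) (integrable_const C) fun t => hC _).trans_eq ?_
    simp
  have hmdir : (Monotone m) ∨ Antitone m := by
    rcases hY with hY | hY
    · exact Or.inl fun x y hxy => integral_mono (hHint x) (hHint y) fun t => hY t hxy
    · exact Or.inr fun x y hxy => integral_mono (hHint y) (hHint x) fun t => hY t hxy
  have hmm : Measurable m := hmdir.elim (fun h => h.measurable) fun h => h.measurable
  have hTlaw : ∀ i y, ∫ ω, H (T i ω, y) ∂μ = m y := fun i y => by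
    have hHy : Measurable fun t => H (t, y) := hm.comp (by fun_prop)
    rw [← integral_map (h.measurable_T i).aemeasurable hHy.aestronglyMeasurable, h.law_T i]
  have hYlaw : ∀ i, ∫ ω, m (Y i ω) ∂μ = ∫ y, m y ∂Q := fun i => by
    rw [← h.law_Y i, integral_map (h.measurable_Y i).aemeasurable hmm.aestronglyMeasurable]
  have hbound : ∀ y : ℕ → ℝ, ∫ t, K (t, y) ∂(μ.map fun ω i => T i ω) ≤
      ∏ i ∈ Finset.range n, m (y i) := fun y => by
    have hKy : Measurable fun t => K (t, y) := hKm.comp (by fun_prop)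
    rw [integral_map hTm.aemeasurable hKy.aestronglyMeasurable]
    refine (h.negAssociated_T.integral_prod_le h.measurable_T (f := fun i t => H (t, y i))
      (fun i x => h0 _) (fun i x => hC _) ?_ n).trans_eq ?_
    · exact hT.imp (fun h i => h _) fun h i => h _
    · simp only [hTlaw]
  calc ∫ ω, ∏ i ∈ Finset.range n, H (T i ω, Y i ω) ∂μ
      = ∫ z, K z ∂(μ.map fun ω => ((fun i => T i ω), fun i => Y i ω)) := by
        rw [integral_map (hTm.prodMk hYm).aemeasurable hKm.aestronglyMeasurable]
    _ = ∫ y, ∫ t, K (t, y) ∂(μ.map fun ω i => T i ω) ∂(μ.map fun ω i => Y i ω) := by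
        rw [hlaw, integral_prod_symm K hKint]
    _ ≤ ∫ y, ∏ i ∈ Finset.range n, m (y i) ∂(μ.map fun ω i => Y i ω) := by
        refine integral_mono hKint.integral_prod_right ?_ hbound
        refine Integrable.of_bound (Finset.measurable_prod _ fun i _ =>
          hmm.comp (measurable_pi_apply i)).aestronglyMeasurable (C ^ n)
          (Eventually.of_forall fun z => ?_)
        rw [Real.norm_of_nonneg (Finset.prod_nonneg fun i _ => hm0 _)]
        refine (Finset.prod_le_prod (fun i _ => hm0 _) fun i _ => hmC _).trans_eq ?_
        simp
    _ = ∫ ω, ∏ i ∈ Finset.range n, m (Y i ω) ∂μ := by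
        have hmn : Measurable fun y : ℕ → ℝ => ∏ i ∈ Finset.range n, m (y i) :=
          Finset.measurable_prod _ fun i _ => hmm.comp (measurable_pi_apply i)
        rw [integral_map hYm.aemeasurable hmn.aestronglyMeasurable]
    _ ≤ ∏ i ∈ Finset.range n, ∫ ω, m (Y i ω) ∂μ :=
        h.negAssociated_Y.integral_prod_le h.measurable_Y (f := fun _ => m) (fun _ => hm0)
          (fun _ => hmC) (hmdir.imp (fun h _ => h) fun h _ => h) n
    _ = (∫ z, H z ∂(P.prod Q)) ^ n := by
        simp only [hYlaw, Finset.prod_const, Finset.card_range]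
        rw [integral_prod_symm]
        exact Integrable.of_bound hm.aestronglyMeasurable C
          (Eventually.of_forall fun t => by rw [Real.norm_of_nonneg (h0 _)]; exact hC _)

/-- Sets of pairs `(t, y)` whose indicator is decreasing in `t` and monotone in `y`. -/
structure BiMonotoneSet (S : Set (ℝ × ℝ)) : Prop where
  measurableSet : MeasurableSet S
  left : ∀ y, IsLowerSet {t | (t, y) ∈ S}
  right : (∀ t, IsLowerSet {y | (t, y) ∈ S}) ∨ ∀ t, IsUpperSet {y | (t, y) ∈ S}

theorem indicator_one_le_indicator_one {S : Set (ℝ × ℝ)} {z w : ℝ × ℝ} (h : z ∈ S → w ∈ S) :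
    S.indicator (1 : ℝ × ℝ → ℝ) z ≤ S.indicator 1 w := by
  by_cases hz : z ∈ S
  · simp [hz, h hz]
  · rw [indicator_of_notMem hz]
    exact indicator_nonneg (fun _ _ => zero_le_one) _

/-- For either sign of `l`, `exp (l * (1_S - p))` is monotone in each coordinate, so the exponential
moment of the sum is at most the `n`-th power of that of one term. Hoeffding's lemma for a variable
in `[0, 1]` gives the parameter `1 / 4` per term. -/
theorem CensoredModel.hasSubgaussianMGF (h : CensoredModel μ T Y P Q) {S : Set (ℝ × ℝ)}
    (hS : BiMonotoneSet S) (n : ℕ) :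
    HasSubgaussianMGF (fun ω => ∑ i ∈ Finset.range n,
      (S.indicator (1 : ℝ × ℝ → ℝ) (T i ω, Y i ω) - (P.prod Q).real S)) (n * (1 / 4)) μ := by
  have := h.isProbabilityMeasure_left
  have := h.isProbabilityMeasure_right
  set p := (P.prod Q).real S with hp
  have hp0 : 0 ≤ p := measureReal_nonneg
  have hp1 : p ≤ 1 := measureReal_le_one
  set ξ : ℝ × ℝ → ℝ := S.indicator 1 with hξ
  have hξm : Measurable ξ := measurable_one.indicator hS.measurableSet
  have hξ0 : ∀ z, 0 ≤ ξ z := fun z => indicator_nonneg (fun _ _ => zero_le_one) z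
  have hξ1 : ∀ z, ξ z ≤ 1 := fun z => indicator_le_self' (fun _ _ => zero_le_one) z
  have hpair : ∀ i, Measurable fun ω => (T i ω, Y i ω) := fun i =>
    (h.measurable_T i).prodMk (h.measurable_Y i)
  have habs : ∀ l z, l * (ξ z - p) ≤ |l| := fun l z => by
    refine (le_abs_self _).trans ?_
    rw [abs_mul]
    refine mul_le_of_le_one_right (abs_nonneg _) (abs_le.2 ⟨?_, ?_⟩) <;>
      linarith [hξ0 z, hξ1 z]
  have hprod : ∀ l ω, Real.exp (l * ∑ i ∈ Finset.range n, (ξ (T i ω, Y i ω) - p)) =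
      ∏ i ∈ Finset.range n, Real.exp (l * (ξ (T i ω, Y i ω) - p)) := fun l ω => by
    rw [Finset.mul_sum, Real.exp_sum]
  constructor
  · intro l
    simp only [hprod]
    refine Integrable.of_bound (Finset.measurable_prod _ fun i _ => ?_).aestronglyMeasurable
      (Real.exp |l| ^ n) (Eventually.of_forall fun ω => ?_)
    · exact Real.measurable_exp.comp (((hξm.comp (hpair i)).sub_const p).const_mul l)
    · rw [Real.norm_of_nonneg (Finset.prod_nonneg fun i _ => (Real.exp_pos _).le)]
      refine (Finset.prod_le_prod (fun i _ => (Real.exp_pos _).le)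
        fun i _ => Real.exp_le_exp.2 (habs l _)).trans_eq ?_
      simp
  · intro l
    have hint : ∫ z, ξ z ∂(P.prod Q) = p := by
      rw [hξ, integral_indicator_one hS.measurableSet]
    have hoeff := (hasSubgaussianMGF_of_mem_Icc (μ := P.prod Q) (X := ξ) (a := 0) (b := 1)
      hξm.aemeasurable (Eventually.of_forall fun z => ⟨hξ0 z, hξ1 z⟩)).mgf_le l
    rw [hint] at hoeff
    have hmain := h.integral_prod_le (H := fun z => Real.exp (l * (ξ z - p))) (C := Real.exp |l|)
      (Real.measurable_exp.comp ((hξm.sub_const p).const_mul l)) (fun z => (Real.exp_pos _).le)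
      (fun z => Real.exp_le_exp.2 (habs l z)) ?_ ?_ n
    · simp only [mgf, hprod] at hoeff ⊢
      refine hmain.trans ((pow_le_pow_left₀ (integral_nonneg fun z => (Real.exp_pos _).le)
        hoeff n).trans_eq ?_)
      rw [← Real.exp_nat_mul]
      congr 1
      simp
      ring
    · rcases le_total 0 l with hl | hl
      · exact Or.inr fun y t t' htt => Real.exp_le_exp.2 (mul_le_mul_of_nonneg_left
          (sub_le_sub_right (indicator_one_le_indicator_one fun hz => hS.left y htt hz) p) hl)
      · exact Or.inl fun y t t' htt => Real.exp_le_exp.2 (mul_le_mul_of_nonpos_left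
          (sub_le_sub_right (indicator_one_le_indicator_one fun hz => hS.left y htt hz) p) hl)
    · rcases le_total 0 l with hl | hl
      · rcases hS.right with hr | hr
        · exact Or.inr fun t y y' hyy => Real.exp_le_exp.2 (mul_le_mul_of_nonneg_left
            (sub_le_sub_right (indicator_one_le_indicator_one fun hz => hr t hyy hz) p) hl)
        · exact Or.inl fun t y y' hyy => Real.exp_le_exp.2 (mul_le_mul_of_nonneg_left
            (sub_le_sub_right (indicator_one_le_indicator_one fun hz => hr t hyy hz) p) hl)
      · rcases hS.right with hr | hr
        · exact Or.inl fun t y y' hyy => Real.exp_le_exp.2 (mul_le_mul_of_nonpos_left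
            (sub_le_sub_right (indicator_one_le_indicator_one fun hz => hr t hyy hz) p) hl)
        · exact Or.inr fun t y y' hyy => Real.exp_le_exp.2 (mul_le_mul_of_nonpos_left
            (sub_le_sub_right (indicator_one_le_indicator_one fun hz => hr t hyy hz) p) hl)

/-- Relative frequency of the set `S` among the first `n` pairs. -/
noncomputable def freq {α : Type*} (T Y : ℕ → α → ℝ) (S : Set (ℝ × ℝ)) (n : ℕ) (ω : α) : ℝ :=
  1 / n * ∑ i ∈ Finset.range n, S.indicator 1 (T i ω, Y i ω)

theorem CensoredModel.hoeffding (h : CensoredModel μ T Y P Q) {S : Set (ℝ × ℝ)}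
    (hS : BiMonotoneSet S) {n : ℕ} (hn : 0 < n) {η : ℝ} (hη : 0 ≤ η) :
    μ.real {ω | η ≤ |freq T Y S n ω - (P.prod Q).real S|} ≤ 2 * Real.exp (-(2 * n * η ^ 2)) := by
  have hn' : (0 : ℝ) < n := Nat.cast_pos.2 hn
  have hsub := h.hasSubgaussianMGF hS n
  have h1 := hsub.measure_ge_le (ε := n * η) (by positivity)
  have h2 := hsub.neg.measure_ge_le (ε := n * η) (by positivity)
  have hexp : -(n * η) ^ 2 / (2 * ((n * (1 / 4) : NNReal) : ℝ)) = -(2 * n * η ^ 2) := by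
    push_cast
    field_simp
    ring
  rw [hexp] at h1 h2
  have heq : ∀ ω, ∑ i ∈ Finset.range n, (S.indicator (1 : ℝ × ℝ → ℝ) (T i ω, Y i ω) -
      (P.prod Q).real S) = n * (freq T Y S n ω - (P.prod Q).real S) := fun ω => by
    rw [Finset.sum_sub_distrib, freq]
    simp
    field_simp
  have hsubset : {ω | η ≤ |freq T Y S n ω - (P.prod Q).real S|} ⊆
      {ω | n * η ≤ ∑ i ∈ Finset.range n, (S.indicator (1 : ℝ × ℝ → ℝ) (T i ω, Y i ω) -
        (P.prod Q).real S)} ∪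
      {ω | n * η ≤ (-fun ω => ∑ i ∈ Finset.range n,
        (S.indicator (1 : ℝ × ℝ → ℝ) (T i ω, Y i ω) - (P.prod Q).real S)) ω} := by
    intro ω hω
    simp only [mem_union, mem_ofPred_eq, Pi.neg_apply, heq] at hω ⊢
    rcases le_abs.1 hω with hω | hω
    · exact Or.inl (mul_le_mul_of_nonneg_left hω hn'.le)
    · refine Or.inr ?_
      rw [← mul_neg]
      exact mul_le_mul_of_nonneg_left hω hn'.le
  refine (measureReal_mono hsubset).trans ((measureReal_union_le _ _).trans ?_)
  linarith

end NegativeAssociation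

/-! ### Quantile grids -/

section Grid

/-- The quantile of order `q` of a finite measure on the line. -/
noncomputable def quantile (ν : Measure ℝ) (q : ℝ) : ℝ := sInf {x | q ≤ ν.real (Iic x)}

variable {ν : Measure ℝ} [IsFiniteMeasure ν] {q : ℝ}

theorem bddBelow_setOf_le_real_Iic (hq : 0 < q) : BddBelow {x | q ≤ ν.real (Iic x)} := by
  have h := tendsto_measure_iInter_atTop (μ := ν) (s := fun n : ℕ => Iic (-(n : ℝ)))
    (fun n => measurableSet_Iic.nullMeasurableSet)
    (fun i j hij => Iic_subset_Iic.2 (neg_le_neg (Nat.cast_le.2 hij))) ⟨0, measure_ne_top _ _⟩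
  have h1 : ⋂ n : ℕ, Iic (-(n : ℝ)) = ∅ := by
    refine eq_empty_of_forall_notMem fun x hx => ?_
    obtain ⟨n, hn⟩ := exists_nat_gt (-x)
    have : x ≤ -(n : ℝ) := mem_iInter.1 hx n
    linarith
  rw [h1, measure_empty] at h
  have h2 := (ENNReal.tendsto_toReal ENNReal.zero_ne_top).comp h
  obtain ⟨n, ha⟩ := (h2.eventually (gt_mem_nhds hq)).exists
  refine ⟨-n, fun x hx => ?_⟩
  by_contra hxa
  have ha' : ν.real (Iic (-(n : ℝ))) < q := ha
  have h3 : ν.real (Iic x) ≤ ν.real (Iic (-(n : ℝ))) :=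
    measureReal_mono (Iic_subset_Iic.2 (not_le.1 hxa).le)
  have h4 : q ≤ ν.real (Iic x) := hx
  linarith

theorem le_real_Iic_of_forall_lt {a : ℝ} (h : ∀ x, a < x → q ≤ ν.real (Iic x)) :
    q ≤ ν.real (Iic a) := by
  obtain ⟨u, hu, hlt, hlim⟩ := exists_seq_strictAnti_tendsto a
  have h1 := tendsto_measure_iInter_atTop (μ := ν) (s := fun n => Iic (u n))
    (fun n => measurableSet_Iic.nullMeasurableSet)
    (fun i j hij => Iic_subset_Iic.2 (hu.antitone hij)) ⟨0, measure_ne_top _ _⟩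
  have h2 : ⋂ n, Iic (u n) = Iic a := by
    ext x
    simp only [mem_iInter, mem_Iic]
    exact ⟨fun hx => ge_of_tendsto' hlim hx, fun hx n => hx.trans (hlt n).le⟩
  rw [h2] at h1
  exact ge_of_tendsto' ((ENNReal.tendsto_toReal (measure_ne_top _ _)).comp h1)
    fun n => h _ (hlt n)

theorem le_real_Iic_quantile (hne : {x | q ≤ ν.real (Iic x)}.Nonempty) :
    q ≤ ν.real (Iic (quantile ν q)) := by
  refine le_real_Iic_of_forall_lt fun x hx => ?_
  obtain ⟨y, hy, hyx⟩ := exists_lt_of_csInf_lt hne hx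
  exact le_trans hy (measureReal_mono (Iic_subset_Iic.2 hyx.le))

theorem real_Iio_quantile_le (hq : 0 < q) : ν.real (Iio (quantile ν q)) ≤ q := by
  obtain ⟨u, hu, hlt, hlim⟩ := exists_seq_strictMono_tendsto (quantile ν q)
  refine le_of_tendsto' (tendsto_real_Iic_Iio ν hu hlt hlim) fun n => ?_
  by_contra hn
  exact not_le.2 (hlt n) (csInf_le (bddBelow_setOf_le_real_Iic hq) (not_le.1 hn).le)

/-- Closeness to a measure at the quantiles of order `j / m` implies uniform closeness. -/
theorem abs_sub_real_Iic_le_of_quantile {m : ℕ} (hm : 0 < m) {ε etot : ℝ}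
    {e e' : ℝ → ℝ} (hν1 : ν.real univ ≤ 1) (h0 : ∀ x, 0 ≤ e x) (hmono : Monotone e)
    (he' : ∀ x y, x < y → e x ≤ e' y) (htot : ∀ x, e x ≤ etot) (hε : 0 ≤ ε)
    (h1 : ∀ j ∈ Finset.range (m + 1),
      |e (quantile ν (j / m)) - ν.real (Iic (quantile ν (j / m)))| ≤ ε)
    (h2 : ∀ j ∈ Finset.range (m + 1),
      |e' (quantile ν (j / m)) - ν.real (Iio (quantile ν (j / m)))| ≤ ε)
    (h3 : |etot - ν.real univ| ≤ ε) (x : ℝ) : |e x - ν.real (Iic x)| ≤ ε + 1 / m := by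
  have hm' : (0 : ℝ) < m := Nat.cast_pos.2 hm
  set c := ν.real (Iic x) with hc
  have hc0 : 0 ≤ c := measureReal_nonneg
  have hc1 : c ≤ 1 := (measureReal_mono (subset_univ _)).trans hν1
  -- The value `c` lies in `[j / m, (j + 1) / m)`: the quantile of order `j / m` bounds `e x` from
  -- below and the one of order `(j + 1) / m` from above. The upper bound uses open half-lines
  -- through `e'`, because `ν` may have atoms at its quantiles.
  set j := ⌊c * m⌋₊ with hj
  have hjle : (j : ℝ) / m ≤ c := by
    rw [div_le_iff₀ hm']; exact Nat.floor_le (by positivity)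
  have hjlt : c < (j : ℝ) / m + 1 / m := by
    rw [← add_div, lt_div_iff₀ hm']; exact Nat.lt_floor_add_one _
  have hjm : j ≤ m := by
    have : (j : ℝ) / m ≤ 1 := hjle.trans hc1
    rw [div_le_one hm'] at this
    exact_mod_cast this
  have hcast : ((j + 1 : ℕ) : ℝ) / m = (j : ℝ) / m + 1 / m := by
    push_cast; rw [add_div]
  rw [abs_le]
  constructor
  · rcases Nat.eq_zero_or_pos j with hj0 | hj0
    · rw [hj0] at hjlt
      simp only [Nat.cast_zero, zero_div, zero_add] at hjlt
      linarith [h0 x]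
    · have hq : (0 : ℝ) < (j : ℝ) / m := by positivity
      have hmem : x ∈ {x | (j : ℝ) / m ≤ ν.real (Iic x)} := hjle
      have hqx : quantile ν (j / m) ≤ x := csInf_le (bddBelow_setOf_le_real_Iic hq) hmem
      have ha := abs_le.1 (h1 j (Finset.mem_range.2 (by omega)))
      have hb := le_real_Iic_quantile ⟨x, hmem⟩
      have hd := hmono hqx
      linarith [ha.1]
  -- If no point reaches level `(j + 1) / m`, then neither does the total mass, and `etot` takes the
  -- place of the grid value.
  · rcases {y | ((j + 1 : ℕ) : ℝ) / m ≤ ν.real (Iic y)}.eq_empty_or_nonempty with hE | hE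
    · have hlim : ν.real univ ≤ ((j + 1 : ℕ) : ℝ) / m := by
        have ht := (ENNReal.tendsto_toReal (measure_ne_top ν univ)).comp
          (tendsto_measure_Iic_atTop ν)
        refine le_of_tendsto' ht fun y => ?_
        by_contra hy
        have : y ∈ {y | ((j + 1 : ℕ) : ℝ) / m ≤ ν.real (Iic y)} := (not_le.1 hy).le
        rw [hE] at this
        exact this
      have := (abs_le.1 h3).2
      linarith [htot x]
    · have hq : (0 : ℝ) < ((j + 1 : ℕ) : ℝ) / m := by positivity
      have hb := le_real_Iic_quantile hE
      have hxq : x < quantile ν (((j + 1 : ℕ) : ℝ) / m) := by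
        by_contra hx
        have : ν.real (Iic (quantile ν (((j + 1 : ℕ) : ℝ) / m))) ≤ c :=
          measureReal_mono (Iic_subset_Iic.2 (not_lt.1 hx))
        linarith
      have hjm' : j + 1 ≤ m := by
        by_contra hlt
        have hjm2 : j = m := by omega
        have h5 : ν.real (Iic (quantile ν (((j + 1 : ℕ) : ℝ) / m))) ≤ 1 :=
          (measureReal_mono (subset_univ _)).trans hν1
        have h6 : (j : ℝ) / m = 1 := by rw [hjm2, div_self hm'.ne']
        have : (0 : ℝ) < 1 / m := by positivity
        linarith
      have ha := abs_le.1 (h2 (j + 1) (Finset.mem_range.2 (by omega)))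
      have hd := real_Iio_quantile_le (ν := ν) hq
      have := he' _ _ hxq
      linarith [ha.2]

end Grid

/-! ### Almost sure uniform rates for empirical functions -/

section Uniform

variable {Ω : Type*} [MeasurableSpace Ω] {μ : Measure Ω} [IsProbabilityMeasure μ]
  {T Y : ℕ → Ω → ℝ} {P Q : Measure ℝ}

/-- The rate `(log n / n)^{1/2}`. -/
noncomputable def rate (n : ℕ) : ℝ := Real.sqrt (Real.log n / n)

theorem rate_nonneg (n : ℕ) : 0 ≤ rate n := Real.sqrt_nonneg _

theorem rate_sq (n : ℕ) : rate n ^ 2 = Real.log n / n :=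
  Real.sq_sqrt (div_nonneg (Real.log_natCast_nonneg n) (Nat.cast_nonneg n))

theorem inv_le_rate {n : ℕ} (hn : 2 ≤ n) : 1 / (n : ℝ) ≤ rate n := by
  have hn' : (2 : ℝ) ≤ n := by exact_mod_cast hn
  have hpos : (0 : ℝ) < n := by linarith
  refine Real.le_sqrt_of_sq_le ?_
  have h1 := Real.one_sub_inv_le_log_of_pos hpos
  have h2 : (n : ℝ)⁻¹ ≤ 2⁻¹ := inv_anti₀ (by norm_num) hn'
  rw [sq, div_mul_eq_mul_div, one_mul]
  refine div_le_div_of_nonneg_right ?_ hpos.le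
  rw [one_div]
  norm_num at h2
  linarith

theorem tendsto_rate : Tendsto rate atTop (𝓝 0) := by
  have h : Tendsto (fun n : ℕ => Real.log n / n) atTop (𝓝 0) :=
    (Real.isLittleO_log_id_atTop.tendsto_div_nhds_zero).comp tendsto_natCast_atTop_atTop
  have h2 := (Real.continuous_sqrt.tendsto 0).comp h
  rw [Real.sqrt_zero] at h2
  exact h2

theorem CensoredModel.ae_eventually_freq (h : CensoredModel μ T Y P Q)
    {S : ℕ → ℕ → Set (ℝ × ℝ)} (hS : ∀ n j, BiMonotoneSet (S n j)) :
    ∀ᵐ ω ∂μ, ∀ᶠ n : ℕ in atTop, ∀ j ∈ Finset.range (n + 1),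
      |freq T Y (S n j) n ω - (P.prod Q).real (S n j)| ≤ 2 * rate n := by
  set B : ℕ → Set Ω := fun n => ⋃ j ∈ Finset.range (n + 1),
    {ω | 0 < n ∧ 2 * rate n ≤ |freq T Y (S n j) n ω - (P.prod Q).real (S n j)|} with hB
  have hle : ∀ n, μ.real (B n) ≤ 4 * (1 / (n : ℝ) ^ 2) := by
    intro n
    rcases Nat.eq_zero_or_pos n with rfl | hn
    · simp [hB]
    have hn1 : (1 : ℝ) ≤ n := by exact_mod_cast hn
    -- The threshold `2 * rate n` makes the Hoeffding exponent `8 * log n`, so a union over `n + 1`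
    -- events remains summable for Borel-Cantelli.
    have hexp : Real.exp (-(2 * n * (2 * rate n) ^ 2)) = 1 / (n : ℝ) ^ 8 := by
      rw [mul_pow, rate_sq]
      have : -(2 * (n : ℝ) * (2 ^ 2 * (Real.log n / n))) = -((8 : ℕ) * Real.log n) := by
        field_simp; norm_num [mul_comm]
      rw [this, Real.exp_neg, Real.exp_nat_mul, Real.exp_log (by linarith), one_div]
    calc μ.real (B n) ≤ ∑ j ∈ Finset.range (n + 1),
          μ.real {ω | 0 < n ∧ 2 * rate n ≤ |freq T Y (S n j) n ω - (P.prod Q).real (S n j)|} :=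
          measureReal_biUnion_finset_le _ _
      _ ≤ ∑ j ∈ Finset.range (n + 1), 2 * (1 / (n : ℝ) ^ 8) := by
          refine Finset.sum_le_sum fun j _ => ?_
          rw [← hexp]
          refine le_trans (measureReal_mono fun ω hω => hω.2)
            (h.hoeffding (hS n j) hn (by have := rate_nonneg n; positivity))
      _ = 2 * (n + 1) * (1 / (n : ℝ) ^ 8) := by simp; ring
      _ ≤ 4 * (1 / (n : ℝ) ^ 2) := by
          rw [mul_one_div, mul_one_div, div_le_div_iff₀ (by positivity) (by positivity)]
          have h6 : (n : ℝ) ≤ n ^ 6 := le_self_pow₀ hn1 (by norm_num)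
          have h7 : (0 : ℝ) ≤ n ^ 2 := by positivity
          nlinarith [mul_le_mul_of_nonneg_right h6 h7]
  have hsum : ∑' n, μ (B n) ≠ ⊤ := by
    have hs : Summable fun n : ℕ => 4 * (1 / (n : ℝ) ^ 2) :=
      (Real.summable_one_div_nat_pow.2 (by norm_num)).mul_left 4
    refine ne_top_of_le_ne_top hs.tsum_ofReal_ne_top (ENNReal.tsum_le_tsum fun n => ?_)
    rw [← ofReal_measureReal (measure_ne_top _ _)]
    exact ENNReal.ofReal_le_ofReal (hle n)
  filter_upwards [ae_eventually_notMem hsum] with ω hω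
  filter_upwards [hω, eventually_gt_atTop 0] with n hn hn0 j hj
  by_contra hlt
  refine hn ?_
  simp only [hB, mem_iUnion]
  exact ⟨j, hj, hn0, (not_le.1 hlt).le⟩

theorem freq_mono {α : Type*} {T Y : ℕ → α → ℝ} {S S' : Set (ℝ × ℝ)} (h : S ⊆ S') (n : ℕ)
    (ω : α) : freq T Y S n ω ≤ freq T Y S' n ω :=
  mul_le_mul_of_nonneg_left (Finset.sum_le_sum fun _ _ =>
    indicator_le_indicator_of_subset h (fun _ => zero_le_one) _) (by positivity)

theorem freq_nonneg {α : Type*} {T Y : ℕ → α → ℝ} (S : Set (ℝ × ℝ)) (n : ℕ) (ω : α) :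
    0 ≤ freq T Y S n ω :=
  mul_nonneg (by positivity) (Finset.sum_nonneg fun _ _ =>
    indicator_nonneg (fun _ _ => zero_le_one) _)

/-- The law of `V` on the event `D`. -/
noncomputable def subLaw (P Q : Measure ℝ) (D : Set (ℝ × ℝ)) (V : ℝ × ℝ → ℝ) : Measure ℝ :=
  ((P.prod Q).restrict D).map V

instance [IsProbabilityMeasure P] [IsProbabilityMeasure Q] (D : Set (ℝ × ℝ)) (V : ℝ × ℝ → ℝ) :
    IsFiniteMeasure (subLaw P Q D V) := by
  unfold subLaw; infer_instance

theorem subLaw_real {D : Set (ℝ × ℝ)} {V : ℝ × ℝ → ℝ} (hV : Measurable V) {A : Set ℝ}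
    (hA : MeasurableSet A) : (subLaw P Q D V).real A = (P.prod Q).real (V ⁻¹' A ∩ D) := by
  rw [subLaw, map_measureReal_apply hV hA, measureReal_restrict_apply (hV hA)]

/-- Glivenko-Cantelli rate for negatively associated data. -/
theorem CensoredModel.ae_eventually_uniform (h : CensoredModel μ T Y P Q) {D : Set (ℝ × ℝ)}
    {V : ℝ × ℝ → ℝ} (hV : Measurable V) (hD : BiMonotoneSet D)
    (hle : ∀ x, BiMonotoneSet (V ⁻¹' Iic x ∩ D)) (hlt : ∀ x, BiMonotoneSet (V ⁻¹' Iio x ∩ D)) :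
    ∀ᵐ ω ∂μ, ∀ᶠ n : ℕ in atTop, ∀ x,
      |freq T Y (V ⁻¹' Iic x ∩ D) n ω - (subLaw P Q D V).real (Iic x)| ≤ 3 * rate n := by
  have := h.isProbabilityMeasure_left
  have := h.isProbabilityMeasure_right
  set ν := subLaw P Q D V with hν
  have h1 := h.ae_eventually_freq (S := fun n j => V ⁻¹' Iic (quantile ν (j / n)) ∩ D)
    fun n j => hle _
  have h2 := h.ae_eventually_freq (S := fun n j => V ⁻¹' Iio (quantile ν (j / n)) ∩ D)
    fun n j => hlt _
  have h3 := h.ae_eventually_freq (S := fun _ _ => D) fun _ _ => hD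
  filter_upwards [h1, h2, h3] with ω h1 h2 h3
  filter_upwards [h1, h2, h3, eventually_ge_atTop 2] with n h1 h2 h3 hn x
  -- With `m = n`, the grid error `1 / n` is at most `rate n`, which turns `2 * rate n` into `3 *
  -- rate n`.
  have hmain := abs_sub_real_Iic_le_of_quantile (ν := ν) (m := n) (by omega) (ε := 2 * rate n)
    (etot := freq T Y D n ω) (e := fun x => freq T Y (V ⁻¹' Iic x ∩ D) n ω)
    (e' := fun x => freq T Y (V ⁻¹' Iio x ∩ D) n ω)
    (by rw [hν, subLaw_real hV MeasurableSet.univ]; exact measureReal_le_one)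
    (fun x => freq_nonneg _ _ _)
    (fun x y hxy => freq_mono
      (inter_subset_inter_left _ (preimage_mono (Iic_subset_Iic.2 hxy))) _ _)
    (fun x y hxy => freq_mono
      (inter_subset_inter_left _ (preimage_mono (Iic_subset_Iio.2 hxy))) _ _)
    (fun x => freq_mono inter_subset_right _ _)
    (by have := rate_nonneg n; positivity)
    (fun j hj => by rw [hν, subLaw_real hV measurableSet_Iic]; exact h1 j hj)
    (fun j hj => by rw [hν, subLaw_real hV measurableSet_Iio]; exact h2 j hj)
    (by
      rw [hν, subLaw_real hV MeasurableSet.univ, preimage_univ, univ_inter]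
      exact h3 0 (by simp)) x
  have := inv_le_rate hn
  linarith

end Uniform

/-! ### Probability integral transform and cumulative hazard -/

section IntegralTransform

variable {P : Measure ℝ} [IsProbabilityMeasure P] [NullSingletonClass P]

theorem tendsto_real_Iic_atBot (P : Measure ℝ) [IsProbabilityMeasure P] :
    Tendsto (fun x => P.real (Iic x)) atBot (𝓝 0) := by
  have h0 : (fun x => P.real (Iic x)) = cdf P := by ext x; rw [cdf_eq_real]
  exact h0 ▸ tendsto_cdf_atBot P

theorem continuous_real_Iic (P : Measure ℝ) [IsProbabilityMeasure P] [NullSingletonClass P] :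
    Continuous fun x => P.real (Iic x) := by
  refine continuous_iff_continuousAt.2 fun a => ?_
  have h1 : Monotone (cdf P) := monotone_cdf P
  have h0 : (fun x => P.real (Iic x)) = cdf P := by ext x; rw [cdf_eq_real]
  rw [h0, h1.continuousAt_iff_leftLim_eq_rightLim, (cdf P).rightLim_eq]
  have h2 := (cdf P).measure_singleton a
  rw [measure_cdf, measure_singleton] at h2
  have h3 := ENNReal.ofReal_eq_zero.1 h2.symm
  exact le_antisymm (h1.leftLim_le le_rfl) (by linarith)

/-- The probability integral transform. -/
theorem map_restrict_Iic_real_Iic (t : ℝ) :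
    (P.restrict (Iic t)).map (fun x => P.real (Iic x)) =
      volume.restrict (Ioc 0 (P.real (Iic t))) := by
  set F : ℝ → ℝ := fun x => P.real (Iic x) with hF
  have hFc : Continuous F := continuous_real_Iic P
  have hFm : Monotone F := fun x y hxy => measureReal_mono (Iic_subset_Iic.2 hxy)
  have : IsFiniteMeasure ((P.restrict (Iic t)).map F) := by infer_instance
  refine Measure.ext_of_Iic _ _ fun u => ?_
  rw [Measure.map_apply hFc.measurable measurableSet_Iic, Measure.restrict_apply
    (hFc.measurable measurableSet_Iic), Measure.restrict_apply measurableSet_Iic, inter_comm (Iic u),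
    Ioc_inter_Iic, Real.volume_Ioc, sub_zero]
  set D : Set ℝ := F ⁻¹' Iic u ∩ Iic t with hD
  rcases le_or_gt (F t) u with hu | hu
  · have : D = Iic t := inter_eq_right.2 fun x hx => (hFm hx).trans hu
    rw [this, inf_of_le_left hu, hF, ofReal_measureReal]
  rw [inf_of_le_right hu.le]
  have hlt : ∀ x, F x < u → x ∈ Iic t := fun x hxu =>
    mem_Iic.2 (le_of_not_gt fun hxt => by linarith [hFm hxt.le])
  rcases D.eq_empty_or_nonempty with hE | hne
  · rw [hE, measure_empty]
    refine (ENNReal.ofReal_eq_zero.2 ?_).symm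
    by_contra hu0
    obtain ⟨x, hx⟩ := ((tendsto_real_Iic_atBot P).eventually
      (gt_mem_nhds (not_le.1 hu0))).exists
    have hxu : F x < u := hx
    have hxD : x ∈ D := ⟨hxu.le, hlt x hxu⟩
    rw [hE] at hxD
    exact hxD
  -- `D` is a nonempty closed lower set bounded above, hence `Iic m`. Continuity forces `F m = u`:
  -- otherwise points just to the right of `m` would still belong to `D`.
  · have hb : BddAbove D := ⟨t, fun x hx => hx.2⟩
    have hcl : IsClosed D := (isClosed_Iic.preimage hFc).inter isClosed_Iic
    have hmem : sSup D ∈ D := hcl.csSup_mem hne hb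
    set m := sSup D with hm
    have hDm : D = Iic m := by
      ext x
      exact ⟨fun hx => le_csSup hb hx, fun hx => ⟨(hFm hx).trans hmem.1, le_trans (mem_Iic.1 hx) (mem_Iic.1 hmem.2)⟩⟩
    have hFmu : F m = u := by
      refine le_antisymm hmem.1 (le_of_not_gt fun hmu => ?_)
      have hev : ∀ᶠ y in 𝓝[>] m, F y < u :=
        mem_nhdsWithin_of_mem_nhds (hFc.continuousAt.eventually (gt_mem_nhds hmu))
      obtain ⟨y, hyu, hym⟩ := (hev.and self_mem_nhdsWithin).exists
      have hyD : y ∈ D := ⟨hyu.le, hlt y hyu⟩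
      exact not_lt.2 (le_csSup hb hyD) hym
    rw [hDm, ← hFmu, hF, ofReal_measureReal]

/-- Substituting `u = P.real (Iic x)` turns the cumulative hazard of an atomless law into the
integral of `(1 - u)⁻¹` over `(0, P.real (Iic t)]`. -/
theorem integral_Iic_inv_real_Ici {t : ℝ} (ht : 0 < P.real (Ioi t)) :
    ∫ x in Iic t, (P.real (Ici x))⁻¹ ∂P = -Real.log (P.real (Ioi t)) := by
  have hIoi : P.real (Ioi t) = 1 - P.real (Iic t) := by
    rw [← compl_Iic, probReal_compl_eq_one_sub measurableSet_Iic]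
  have hIci : ∀ x, P.real (Ici x) = 1 - P.real (Iic x) := fun x => by
    rw [← compl_Iio, probReal_compl_eq_one_sub measurableSet_Iio, measureReal_def,
      measureReal_def, Iio_ae_eq_Iic.measure_eq]
  have hmeas : Measurable fun u : ℝ => (1 - u)⁻¹ := by fun_prop
  simp only [hIci]
  rw [← integral_map (f := fun u => (1 - u)⁻¹)
    (continuous_real_Iic P).measurable.aemeasurable hmeas.aestronglyMeasurable,
    map_restrict_Iic_real_Iic, ← intervalIntegral.integral_of_le measureReal_nonneg,
    intervalIntegral.integral_comp_sub_left (fun u => u⁻¹), integral_inv, hIoi]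
  · rw [sub_zero, one_div, Real.log_inv]
  · rw [sub_zero, ← hIoi]
    exact notMem_uIcc_of_lt ht one_pos

end IntegralTransform

/-! ### Empirical measures as sums of point masses -/

section Empirical

open Classical in
theorem empCDF_measure (n : ℕ) (x : ℕ → ℝ) (δ : ℕ → Prop) :
    (empCDF n x δ).measure = ENNReal.ofReal (1 / n) •
      ∑ i ∈ (Finset.range n).filter δ, Measure.dirac (x i) := by
  have hfin : IsFiniteMeasure (ENNReal.ofReal (1 / n) •
      ∑ i ∈ (Finset.range n).filter δ, Measure.dirac (x i)) := by
    refine ⟨?_⟩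
    simp [ENNReal.mul_lt_top_iff]
  refine (Measure.ext_of_Iic _ _ fun a => ?_).symm
  have hbot : Tendsto (empCDF n x δ) atBot (𝓝 0) := by
    refine tendsto_const_nhds.congr' ?_
    have : ∀ᶠ t in atBot, ∀ i ∈ Finset.range n, t < x i :=
      (Filter.eventually_all_finset _).2 fun i _ => eventually_lt_atBot (x i)
    filter_upwards [this] with t ht
    have : events n x δ t = 0 := by
      rw [events, Finset.card_eq_zero, Finset.filter_eq_empty_iff]
      exact fun i hi h => not_lt.2 h.1 (ht i hi)
    change 0 = 1 / (n : ℝ) * (events n x δ t : ℝ)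
    simp [this]
  rw [StieltjesFunction.measure_Iic _ hbot, sub_zero]
  change _ = ENNReal.ofReal (1 / (n : ℝ) * (events n x δ a : ℝ))
  rw [ENNReal.ofReal_mul (by positivity), ENNReal.ofReal_natCast]
  simp only [Measure.smul_apply, Measure.finsetSum_apply, smul_eq_mul, measurableSet_Iic,
    Measure.dirac_apply']
  congr 1
  rw [events, Finset.card_filter, Finset.sum_filter]
  push_cast
  refine Finset.sum_congr rfl fun i _ => ?_
  by_cases h1 : δ i <;> by_cases h2 : x i ≤ a <;> simp [h1, h2]

instance (n : ℕ) (x : ℕ → ℝ) (δ : ℕ → Prop) : IsFiniteMeasure (empCDF n x δ).measure := by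
  classical
  rw [empCDF_measure]
  refine ⟨?_⟩
  simp [ENNReal.mul_lt_top_iff]

open Classical in
theorem integral_empCDF (n : ℕ) (x : ℕ → ℝ) (δ : ℕ → Prop) (φ : ℝ → ℝ) :
    ∫ y, φ y ∂(empCDF n x δ).measure = 1 / n * ∑ i ∈ (Finset.range n).filter δ, φ (x i) := by
  rw [empCDF_measure, integral_smul_measure, integral_finsetSum_measure
    (fun i _ => integrable_dirac (by simp)), ENNReal.toReal_ofReal (by positivity)]
  simp

open Classical in
theorem real_empCDF (n : ℕ) (x : ℕ → ℝ) (δ : ℕ → Prop) {A : Set ℝ} (hA : MeasurableSet A) :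
    (empCDF n x δ).measure.real A =
      1 / n * (((Finset.range n).filter fun i => x i ∈ A ∧ δ i).card : ℝ) := by
  rw [← integral_indicator_one hA, integral_empCDF, Finset.card_filter, Finset.sum_filter]
  push_cast
  congr 1
  refine Finset.sum_congr rfl fun i _ => ?_
  by_cases h1 : δ i <;> by_cases h2 : x i ∈ A <;> simp [h1, h2]

theorem real_empCDF_singleton (n : ℕ) (x : ℕ → ℝ) (δ : ℕ → Prop) (t : ℝ) :
    (empCDF n x δ).measure.real {t} = 1 / n * (eventJump n x δ t : ℝ) := by
  classical
  rw [real_empCDF _ _ _ (measurableSet_singleton t), eventJump]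
  simp only [mem_singleton_iff]

theorem real_empCDF_Ici (n : ℕ) (x : ℕ → ℝ) (t : ℝ) :
    (empCDF n x fun _ => True).measure.real (Ici t) = 1 / n * (atRisk n x t : ℝ) := by
  classical
  rw [real_empCDF _ _ _ measurableSet_Ici, atRisk]
  simp only [mem_Ici, and_true]

/-- The Nelson-Aalen sum as a sum over uncensored observations. -/
theorem sum_eventJump_mul (n : ℕ) (x : ℕ → ℝ) (δ : ℕ → Prop) (g : ℝ → ℝ) (t : ℝ) :
    1 / (n : ℝ) * ∑ s ∈ ((Finset.range n).image x).filter (fun s => s ≤ t),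
      (eventJump n x δ s : ℝ) * g s =
    ∫ y, (Iic t).indicator g y ∂(empCDF n x δ).measure := by
  classical
  rw [integral_empCDF]
  congr 1
  have hmaps : ∀ i ∈ (Finset.range n).filter (fun i => x i ≤ t ∧ δ i),
      x i ∈ ((Finset.range n).image x).filter (fun s => s ≤ t) := fun i hi => by
    rw [Finset.mem_filter] at hi ⊢
    exact ⟨Finset.mem_image_of_mem x hi.1, hi.2.1⟩
  have h1 : ∑ i ∈ (Finset.range n).filter δ, (Iic t).indicator g (x i) =
      ∑ i ∈ (Finset.range n).filter (fun i => x i ≤ t ∧ δ i), g (x i) := by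
    rw [Finset.sum_filter, Finset.sum_filter]
    refine Finset.sum_congr rfl fun i _ => ?_
    by_cases h1 : δ i <;> by_cases h2 : x i ≤ t <;> simp [h1, h2]
  rw [h1, ← Finset.sum_fiberwise_of_maps_to hmaps]
  refine Finset.sum_congr rfl fun s hs => ?_
  rw [eventJump, ← nsmul_eq_mul, ← Finset.sum_const]
  refine Finset.sum_congr ?_ fun i hi => ?_
  · ext i
    have := (Finset.mem_filter.1 hs).2
    simp only [Finset.mem_filter]
    constructor
    · rintro ⟨h1, rfl, h3⟩; exact ⟨⟨h1, this, h3⟩, rfl⟩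
    · rintro ⟨⟨h1, h2, h3⟩, rfl⟩; exact ⟨h1, rfl, h3⟩
  · rw [(Finset.mem_filter.1 hi).2]

end Empirical

/-! ### Products and exponentials -/

section ProductLimit

theorem abs_prod_sub_prod_le {ι : Type*} (S : Finset ι) {a b : ι → ℝ}
    (ha0 : ∀ i ∈ S, 0 ≤ a i) (ha1 : ∀ i ∈ S, a i ≤ 1) (hb0 : ∀ i ∈ S, 0 ≤ b i)
    (hb1 : ∀ i ∈ S, b i ≤ 1) :
    |∏ i ∈ S, a i - ∏ i ∈ S, b i| ≤ ∑ i ∈ S, |a i - b i| := by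
  classical
  induction S using Finset.induction_on with
  | empty => simp
  | insert i S hi ih =>
    rw [Finset.prod_insert hi, Finset.prod_insert hi, Finset.sum_insert hi]
    have h1 := ih (fun j hj => ha0 j (Finset.mem_insert_of_mem hj))
      (fun j hj => ha1 j (Finset.mem_insert_of_mem hj))
      (fun j hj => hb0 j (Finset.mem_insert_of_mem hj))
      (fun j hj => hb1 j (Finset.mem_insert_of_mem hj))
    have hA0 : 0 ≤ ∏ j ∈ S, a j :=
      Finset.prod_nonneg fun j hj => ha0 j (Finset.mem_insert_of_mem hj)
    have hA1 : ∏ j ∈ S, a j ≤ 1 := Finset.prod_le_one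
      (fun j hj => ha0 j (Finset.mem_insert_of_mem hj))
      fun j hj => ha1 j (Finset.mem_insert_of_mem hj)
    have hi' := Finset.mem_insert_self i S
    calc |a i * ∏ j ∈ S, a j - b i * ∏ j ∈ S, b j|
        = |(a i - b i) * ∏ j ∈ S, a j + b i * (∏ j ∈ S, a j - ∏ j ∈ S, b j)| := by
          congr 1; ring
      _ ≤ |a i - b i| * |∏ j ∈ S, a j| + |b i| * |∏ j ∈ S, a j - ∏ j ∈ S, b j| := by
          rw [← abs_mul, ← abs_mul]; exact abs_add_le _ _
      _ ≤ |a i - b i| + ∑ j ∈ S, |a j - b j| := by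
          refine add_le_add (mul_le_of_le_one_right (abs_nonneg _) ?_) ?_
          · rwa [abs_of_nonneg hA0]
          · refine (mul_le_of_le_one_left (abs_nonneg _) ?_).trans h1
            rw [abs_of_nonneg (hb0 i hi')]; exact hb1 i hi'

/-- Compare factor by factor: `1 - d` and `exp (-d)` differ by at most `d ^ 2 ≤ η * d`. -/
theorem abs_prod_one_sub_sub_exp_le {ι : Type*} (S : Finset ι) {d : ι → ℝ} {η : ℝ}
    (h0 : ∀ i ∈ S, 0 ≤ d i) (h1 : ∀ i ∈ S, d i ≤ 1) (hη : ∀ i ∈ S, d i ≤ η) :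
    |∏ i ∈ S, (1 - d i) - Real.exp (-∑ i ∈ S, d i)| ≤ η * ∑ i ∈ S, d i := by
  rw [← Finset.sum_neg_distrib, Real.exp_sum, Finset.mul_sum]
  refine (abs_prod_sub_prod_le S (fun i hi => by linarith [h1 i hi])
    (fun i hi => by linarith [h0 i hi]) (fun i _ => (Real.exp_pos _).le)
    (fun i hi => Real.exp_le_one_iff.2 (by linarith [h0 i hi]))).trans
    (Finset.sum_le_sum fun i hi => ?_)
  have h := Real.abs_exp_sub_one_sub_id_le (x := -d i)
    (by rw [abs_neg, abs_of_nonneg (h0 i hi)]; exact h1 i hi)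
  rw [abs_sub_comm]
  have heq : Real.exp (-d i) - (1 - d i) = Real.exp (-d i) - 1 - -d i := by ring
  rw [heq]
  refine h.trans ?_
  rw [neg_sq, sq]
  exact mul_le_mul_of_nonneg_right (hη i hi) (h0 i hi)

theorem abs_exp_neg_sub_exp_neg_le {x y : ℝ} (hx : 0 ≤ x) (hy : 0 ≤ y) :
    |Real.exp (-x) - Real.exp (-y)| ≤ |x - y| := by
  wlog hxy : x ≤ y generalizing x y
  · rw [abs_sub_comm, abs_sub_comm x]
    exact this hy hx (not_le.1 hxy).le
  have h1 : Real.exp (-y) = Real.exp (-x) * Real.exp (x - y) := by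
    rw [← Real.exp_add]; congr 1; ring
  have h2 := Real.add_one_le_exp (x - y)
  have h3 : Real.exp (-x) ≤ 1 := Real.exp_le_one_iff.2 (by linarith)
  have h4 := Real.exp_pos (-x)
  have h5 : Real.exp (x - y) ≤ 1 := Real.exp_le_one_iff.2 (by linarith)
  rw [abs_of_nonneg (by rw [h1]; nlinarith), abs_of_nonpos (by linarith), h1]
  nlinarith

end ProductLimit

/-! ### Population laws of the observations -/

section Population

variable {P Q : Measure ℝ} [IsProbabilityMeasure P] [IsProbabilityMeasure Q]

/-- The pairs (lifetime, censoring time) that lead to an uncensored observation. -/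
def uncensoredSet : Set (ℝ × ℝ) := {z | z.1 ≤ z.2}

theorem measurableSet_uncensoredSet : MeasurableSet uncensoredSet :=
  measurableSet_le measurable_fst measurable_snd

/-- The smaller coordinate. -/
def minPair (z : ℝ × ℝ) : ℝ := min z.1 z.2

theorem measurable_minPair : Measurable minPair := measurable_fst.min measurable_snd

/-- Given the lifetime `t`, the observation is uncensored exactly when the censoring time is at
least `t`, and then it equals `t`. The resulting weight `Q.real (Ici x)` later cancels the censoring
factor in the at-risk probability. -/
theorem integral_subLaw_uncensored {φ : ℝ → ℝ} (hφ : Measurable φ) {M : ℝ}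
    (hM : ∀ x, |φ x| ≤ M) :
    ∫ x, φ x ∂(subLaw P Q uncensoredSet minPair) = ∫ x, φ x * Q.real (Ici x) ∂P := by
  rw [subLaw, integral_map measurable_minPair.aemeasurable hφ.aestronglyMeasurable,
    ← integral_indicator measurableSet_uncensoredSet, integral_prod]
  · refine integral_congr_ae (Eventually.of_forall fun t => ?_)
    have : ∀ y, uncensoredSet.indicator (fun z => φ (minPair z)) (t, y) =
        (Ici t).indicator (fun _ => φ t) y := fun y => by
      by_cases h : t ≤ y
      · rw [indicator_of_mem (show (t, y) ∈ uncensoredSet from h),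
          indicator_of_mem (mem_Ici.2 h), minPair, min_eq_left h]
      · rw [indicator_of_notMem (show (t, y) ∉ uncensoredSet from h),
          indicator_of_notMem (fun h' => h (mem_Ici.1 h'))]
    simp only [this]
    rw [integral_indicator_const _ measurableSet_Ici, smul_eq_mul, mul_comm]
  · refine Integrable.of_bound ((hφ.comp measurable_minPair).indicator
      measurableSet_uncensoredSet).aestronglyMeasurable M (Eventually.of_forall fun z => ?_)
    exact (norm_indicator_le_norm_self _ z).trans (hM _)

theorem prod_real_Ici_minPair (P Q : Measure ℝ) [IsProbabilityMeasure Q] (s : ℝ) :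
    (P.prod Q).real (minPair ⁻¹' Ici s) = P.real (Ici s) * Q.real (Ici s) := by
  have : minPair ⁻¹' Ici s = Ici s ×ˢ Ici s := by
    ext z; exact le_min_iff (a := z.1) (b := z.2) (c := s)
  rw [this, measureReal_prod_prod]

theorem prod_real_Ioi_minPair (P Q : Measure ℝ) [IsProbabilityMeasure Q] (s : ℝ) :
    (P.prod Q).real (minPair ⁻¹' Ioi s) = P.real (Ioi s) * Q.real (Ioi s) := by
  have : minPair ⁻¹' Ioi s = Ioi s ×ˢ Ioi s := by
    ext z; exact lt_min_iff (a := s) (b := z.1) (c := z.2)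
  rw [this, measureReal_prod_prod]

theorem subLaw_uncensored_singleton [NullSingletonClass P] (s : ℝ) :
    (subLaw P Q uncensoredSet minPair).real {s} = 0 := by
  have h := integral_subLaw_uncensored (P := P) (Q := Q) (φ := ({s} : Set ℝ).indicator 1)
    (measurable_one.indicator (measurableSet_singleton s)) (M := 1) fun x => by
      by_cases h : x = s <;> simp [h]
  rw [integral_indicator_one (measurableSet_singleton s)] at h
  rw [h]
  refine integral_eq_zero_of_ae ?_
  have : ∀ᵐ x ∂P, x ≠ s := by
    rw [ae_iff]; simp
  filter_upwards [this] with x hx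
  simp [hx]

end Population

/-! ### Deterministic error bound for the Kaplan-Meier estimator -/

section KaplanMeier

variable {P Q : Measure ℝ} [IsProbabilityMeasure P] [IsProbabilityMeasure Q]
  [NullSingletonClass P]

/-- Errors on the scale `ε / a₀ ^ 2`: `8` for replacing the product by an exponential, `2` for
replacing the empirical at-risk fraction `A` by its population value `a`, and `2` for replacing the
empirical measure of uncensored observations by its law. -/
theorem abs_kmSurv_sub_le {c : ℝ} {a₀ : ℝ} (ha₀ : 0 < a₀)
    (hPQ : a₀ ≤ P.real (Ioi c) * Q.real (Ioi c)) {n : ℕ} (hn : 0 < n) {x : ℕ → ℝ} {δ : ℕ → Prop}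
    {ε : ℝ} (hε : 0 ≤ ε) (hεa : ε ≤ a₀ / 2)
    (hN : ∀ y, |(empCDF n x δ).measure.real (Iic y) -
      (subLaw P Q uncensoredSet minPair).real (Iic y)| ≤ ε)
    (hX : ∀ y, |(empCDF n x fun _ => True).measure.real (Iic y) -
      (subLaw P Q univ minPair).real (Iic y)| ≤ ε) {t : ℝ} (ht : t ≤ c) :
    |kmSurv n x δ t - P.real (Ioi t)| ≤ 12 / a₀ ^ 2 * ε := by
  classical
  have hn' : (0 : ℝ) < n := Nat.cast_pos.2 hn
  set ρ := (empCDF n x δ).measure with hρ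
  set ν := subLaw P Q uncensoredSet minPair with hν
  set a : ℝ → ℝ := fun s => P.real (Ici s) * Q.real (Ici s) with ha
  set A : ℝ → ℝ := fun s => 1 / n * (atRisk n x s : ℝ) with hA
  have ha₀1 : a₀ ≤ 1 := hPQ.trans (mul_le_one₀ measureReal_le_one measureReal_nonneg
    measureReal_le_one)
  have ha_ge : ∀ s ≤ c, a₀ ≤ a s := fun s hs => hPQ.trans <|
    mul_le_mul (measureReal_mono (Ioi_subset_Ici hs)) (measureReal_mono (Ioi_subset_Ici hs))
      measureReal_nonneg measureReal_nonneg
  have hAa : ∀ s, |A s - a s| ≤ ε := by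
    intro s
    have h1 := abs_real_Iio_sub_le (c := s) (fun y _ => hX y) le_rfl
    have hu : (empCDF n x fun _ => True).measure.real univ = 1 := by
      rw [real_empCDF _ _ _ MeasurableSet.univ]
      simp [hn'.ne']
    have hu2 : (subLaw P Q univ minPair).real univ = 1 := by
      rw [subLaw_real measurable_minPair MeasurableSet.univ]; simp
    have h2 : (empCDF n x fun _ => True).measure.real (Iio s) = 1 - A s := by
      simp only [hA]
      rw [← real_empCDF_Ici, ← compl_Iio, measureReal_compl measurableSet_Iio, hu]; ring
    have h3 : (subLaw P Q univ minPair).real (Iio s) = 1 - a s := by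
      simp only [ha]
      rw [← prod_real_Ici_minPair, ← inter_univ (minPair ⁻¹' Ici s),
        ← subLaw_real measurable_minPair measurableSet_Ici, ← compl_Iio,
        measureReal_compl measurableSet_Iio, hu2]; ring
    rw [h2, h3, abs_sub_comm] at h1
    convert h1 using 2
    ring
  have hA_ge : ∀ s ≤ c, a₀ / 2 ≤ A s := fun s hs => by
    have := (abs_le.1 (hAa s)).1
    linarith [ha_ge s hs]
  -- The limiting law has no atoms, so Kolmogorov closeness alone makes all empirical jumps small;
  -- this bounds every hazard increment `d s`.
  have hjump : ∀ s, 1 / (n : ℝ) * (eventJump n x δ s : ℝ) ≤ 2 * ε := by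
    intro s
    have h := abs_real_ordConnected_sub_le (c := s) hε (fun y _ => hN y)
      (S := {s}) ordConnected_singleton (by simp)
    rw [subLaw_uncensored_singleton, sub_zero, real_empCDF_singleton] at h
    exact (le_abs_self _).trans h
  set S := ((Finset.range n).image x).filter (fun s => s ≤ t) with hS
  set d : ℝ → ℝ := fun s => (eventJump n x δ s : ℝ) / (atRisk n x s : ℝ) with hd
  have hSc : ∀ s ∈ S, s ≤ c := fun s hs => (Finset.mem_filter.1 hs).2.trans ht
  have hd0 : ∀ s, 0 ≤ d s := fun s => by simp only [hd]; positivity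
  have hd1 : ∀ s, d s ≤ 1 := fun s => by linarith [(kmFactor_mem n x δ s).1]
  have hdA : ∀ s, d s = 1 / n * (eventJump n x δ s * (A s)⁻¹) := fun s => by
    simp only [hd, hA]
    rw [mul_inv, one_div, inv_inv]
    field_simp
  have hdη : ∀ s ∈ S, d s ≤ 4 / a₀ * ε := fun s hs => by
    have h1 := hA_ge s (hSc s hs)
    rw [hdA, ← mul_assoc]
    calc 1 / (n : ℝ) * (eventJump n x δ s) * (A s)⁻¹ ≤ 2 * ε * (a₀ / 2)⁻¹ :=
          mul_le_mul (hjump s) (inv_anti₀ (by positivity) h1)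
            (inv_nonneg.2 (le_trans (by positivity) h1)) (by positivity)
      _ = 4 / a₀ * ε := by field_simp; ring
  have hρ1 : ρ.real univ ≤ 1 := by
    rw [hρ, real_empCDF _ _ _ MeasurableSet.univ, one_div, ← div_eq_inv_mul]
    refine div_le_one_of_le₀ (Nat.cast_le.2 ?_) hn'.le
    refine (Finset.card_le_card (t := Finset.range n) fun i hi => ?_).trans (by simp)
    simp only [Finset.mem_filter] at hi
    exact hi.1
  have hsum : ∑ s ∈ S, d s = ∫ y, (Iic t).indicator (fun s => (A s)⁻¹) y ∂ρ := by
    rw [← sum_eventJump_mul, Finset.mul_sum]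
    exact Finset.sum_congr rfl fun s _ => hdA s
  have hAanti : MonotoneOn (fun s => (A s)⁻¹) (Iic t) := fun y hy z hz hyz => by
    refine inv_anti₀ (lt_of_lt_of_le (by positivity) (hA_ge z (le_trans hz ht))) ?_
    simp only [hA]
    refine mul_le_mul_of_nonneg_left (Nat.cast_le.2 (Finset.card_le_card ?_)) (by positivity)
    exact Finset.monotone_filter_right _ fun k _ hk => hyz.trans hk
  have hUA : UnimodalLE t (2 / a₀) ((Iic t).indicator fun s => (A s)⁻¹) :=
    unimodalLE_indicator_of_monotoneOn ordConnected_Iic subset_rfl hAanti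
      (fun y hy => inv_nonneg.2 (le_trans (by positivity) (hA_ge y (le_trans hy ht))))
      (by positivity)
      fun y hy => by
        rw [← inv_div]
        exact inv_anti₀ (by positivity) (hA_ge y (le_trans hy ht))
  have haanti : MonotoneOn (fun s => (a s)⁻¹) (Iic t) := fun y hy z hz hyz => by
    refine inv_anti₀ (lt_of_lt_of_le ha₀ (ha_ge z (le_trans hz ht))) ?_
    exact mul_le_mul (measureReal_mono (Ici_subset_Ici.2 hyz))
      (measureReal_mono (Ici_subset_Ici.2 hyz)) measureReal_nonneg measureReal_nonneg
  have hUa : UnimodalLE t (1 / a₀) ((Iic t).indicator fun s => (a s)⁻¹) :=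
    unimodalLE_indicator_of_monotoneOn ordConnected_Iic subset_rfl haanti
      (fun y hy => inv_nonneg.2 (ha₀.le.trans (ha_ge y (le_trans hy ht))))
      (by positivity)
      fun y hy => by
        rw [one_div]
        exact inv_anti₀ ha₀ (ha_ge y (le_trans hy ht))
  have hsum0 : 0 ≤ ∑ s ∈ S, d s := Finset.sum_nonneg fun s _ => hd0 s
  have hsum1 : ∑ s ∈ S, d s ≤ 2 / a₀ := by
    rw [hsum]
    refine (integral_mono (hUA.integrable ρ) (integrable_const (2 / a₀)) hUA.le).trans ?_
    rw [integral_const, smul_eq_mul]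
    exact mul_le_of_le_one_left (by positivity) hρ1
  have hstep1 : |kmSurv n x δ t - Real.exp (-∑ s ∈ S, d s)| ≤ 8 / a₀ ^ 2 * ε := by
    refine (abs_prod_one_sub_sub_exp_le S (fun s _ => hd0 s) (fun s _ => hd1 s) hdη).trans ?_
    calc 4 / a₀ * ε * ∑ s ∈ S, d s ≤ 4 / a₀ * ε * (2 / a₀) :=
          mul_le_mul_of_nonneg_left hsum1 (by positivity)
      _ = 8 / a₀ ^ 2 * ε := by field_simp; ring
  have hstep2 : |∑ s ∈ S, d s - ∫ y, (Iic t).indicator (fun s => (a s)⁻¹) y ∂ρ| ≤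
      2 / a₀ ^ 2 * ε := by
    rw [hsum, ← integral_sub (hUA.integrable ρ) (hUa.integrable ρ), ← Real.norm_eq_abs]
    refine (norm_integral_le_of_norm_le_const (C := 2 / a₀ ^ 2 * ε)
      (Eventually.of_forall fun y => ?_)).trans
      (mul_le_of_le_one_right (by positivity) hρ1)
    by_cases hy : y ∈ Iic t
    · have h1 := ha_ge y (le_trans hy ht)
      have h2 := hA_ge y (le_trans hy ht)
      have h1' : 0 < a y := ha₀.trans_le h1
      have h2' : 0 < A y := lt_of_lt_of_le (by positivity) h2
      rw [indicator_of_mem hy, indicator_of_mem hy, Real.norm_eq_abs,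
        inv_sub_inv h2'.ne' h1'.ne', abs_div, abs_of_pos (mul_pos h2' h1'), abs_sub_comm]
      calc |A y - a y| / (A y * a y) ≤ ε / (a₀ / 2 * a₀) :=
            div_le_div₀ hε (hAa y) (by positivity)
              (mul_le_mul h2 h1 ha₀.le h2'.le)
        _ = 2 / a₀ ^ 2 * ε := by field_simp
    · rw [indicator_of_notMem hy, indicator_of_notMem hy, sub_zero, norm_zero]
      positivity
  -- The integrand `1 / a` is increasing up to `t` and cut off after it, hence unimodal, so the
  -- Kolmogorov bound applies to it.
  have hstep3 := hUa.abs_integral_sub_le (μ := ρ) (ν := ν) hε fun y _ => hN y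
  have hPt : 0 < P.real (Ioi t) := by
    have h1 : 0 < P.real (Ioi c) * Q.real (Ioi c) := ha₀.trans_le hPQ
    have h2 : 0 < P.real (Ioi c) := pos_of_mul_pos_left h1 measureReal_nonneg
    exact h2.trans_le (measureReal_mono (Ioi_subset_Ioi ht))
  -- The factor `Q.real (Ici y)` cancels, leaving the cumulative hazard of `P` alone.
  have hpop : ∫ y, (Iic t).indicator (fun s => (a s)⁻¹) y ∂ν = -Real.log (P.real (Ioi t)) := by
    rw [hν, integral_subLaw_uncensored hUa.measurable (M := 1 / a₀) fun y => by
      rw [abs_of_nonneg (hUa.nonneg y)]; exact hUa.le y]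
    rw [← integral_Iic_inv_real_Ici hPt, ← integral_indicator measurableSet_Iic]
    congr 1
    ext y
    by_cases hy : y ∈ Iic t
    · rw [indicator_of_mem hy, indicator_of_mem hy]
      have h1 : 0 < a y := ha₀.trans_le (ha_ge y (le_trans hy ht))
      have h2 : Q.real (Ici y) ≠ 0 := fun h => by simp [ha, h] at h1
      simp only [ha]
      rw [mul_inv, mul_assoc, inv_mul_cancel₀ h2, mul_one]
    · rw [indicator_of_notMem hy, indicator_of_notMem hy, zero_mul]
  rw [hpop] at hstep3
  have hlog : 0 ≤ -Real.log (P.real (Ioi t)) :=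
    neg_nonneg.2 (Real.log_nonpos measureReal_nonneg measureReal_le_one)
  have hstep4 := abs_exp_neg_sub_exp_neg_le hsum0 hlog
  rw [neg_neg, Real.exp_log hPt] at hstep4
  have hfin : 2 * ε * (1 / a₀) ≤ 2 / a₀ ^ 2 * ε := by
    have h1 : 1 / a₀ ≤ 1 / a₀ ^ 2 :=
      one_div_le_one_div_of_le (by positivity) (pow_le_of_le_one ha₀.le ha₀1 two_ne_zero)
    calc 2 * ε * (1 / a₀) ≤ 2 * ε * (1 / a₀ ^ 2) := mul_le_mul_of_nonneg_left h1 (by positivity)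
      _ = 2 / a₀ ^ 2 * ε := by ring
  calc |kmSurv n x δ t - P.real (Ioi t)|
      ≤ |kmSurv n x δ t - Real.exp (-∑ s ∈ S, d s)| +
        |Real.exp (-∑ s ∈ S, d s) - P.real (Ioi t)| := abs_sub_le _ _ _
    _ ≤ 8 / a₀ ^ 2 * ε + (2 / a₀ ^ 2 * ε + 2 / a₀ ^ 2 * ε) :=
        add_le_add hstep1 (hstep4.trans ((abs_sub_le _ _ _).trans
          (add_le_add hstep2 (hstep3.trans hfin))))
    _ = 12 / a₀ ^ 2 * ε := by ring

end KaplanMeier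

/-! ### Monotone events of the censoring model -/

section BiMonotone

theorem biMonotoneSet_univ : BiMonotoneSet univ :=
  ⟨MeasurableSet.univ, fun _ _ _ _ _ => mem_univ _, Or.inl fun _ _ _ _ _ => mem_univ _⟩

theorem biMonotoneSet_uncensored : BiMonotoneSet uncensoredSet :=
  ⟨measurableSet_uncensoredSet, fun _ _ _ htt (h : _ ≤ _) => le_trans htt h,
    Or.inr fun _ _ _ hyy (h : _ ≤ _) => le_trans h hyy⟩

theorem biMonotoneSet_minPair_preimage {A : Set ℝ} (hA : IsLowerSet A) :
    BiMonotoneSet (minPair ⁻¹' A ∩ univ) := by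
  rw [inter_univ]
  exact ⟨measurable_minPair hA.ordConnected.measurableSet,
    fun y t t' htt h => hA (min_le_min_right y htt) h,
    Or.inl fun t y y' hyy h => hA (min_le_min_left t hyy) h⟩

/-- On the uncensored set the minimum is the lifetime, so raising the censoring time leaves the
observation unchanged and uncensored. -/
theorem biMonotoneSet_minPair_preimage_uncensored {A : Set ℝ} (hA : IsLowerSet A) :
    BiMonotoneSet (minPair ⁻¹' A ∩ uncensoredSet) := by
  refine ⟨(measurable_minPair hA.ordConnected.measurableSet).inter measurableSet_uncensoredSet,
    fun y t t' htt h => ⟨hA (min_le_min_right y htt) h.1, le_trans htt h.2⟩,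
    Or.inr fun t y y' hyy h => ⟨hA ?_ h.1, le_trans h.2 hyy⟩⟩
  have h2 : t ≤ y := h.2
  simp only [minPair]
  rw [min_eq_left h2]
  exact min_le_left _ _

theorem biMonotoneSet_fst_preimage {A : Set ℝ} (hA : IsLowerSet A) :
    BiMonotoneSet (Prod.fst ⁻¹' A ∩ univ) := by
  rw [inter_univ]
  exact ⟨measurable_fst hA.ordConnected.measurableSet, fun y t t' htt h => hA htt h,
    Or.inl fun t y y' hyy h => h⟩

end BiMonotone

/-! ### Uniform rates for the kernel smoothers -/

section Smoothing

theorem freq_eq_real_empCDF {α : Type*} {T Y : ℕ → α → ℝ} (V : ℝ × ℝ → ℝ) (D : Set (ℝ × ℝ))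
    {A : Set ℝ} (hA : MeasurableSet A) (n : ℕ) (ω : α) :
    freq T Y (V ⁻¹' A ∩ D) n ω = (empCDF n (fun i => V (T i ω, Y i ω))
      fun i => (T i ω, Y i ω) ∈ D).measure.real A := by
  classical
  rw [← integral_indicator_one hA, integral_empCDF, Finset.sum_filter, freq]
  congr 1
  refine Finset.sum_congr rfl fun i _ => ?_
  by_cases h1 : (T i ω, Y i ω) ∈ D <;> by_cases h2 : V (T i ω, Y i ω) ∈ A <;>
    simp [h1, h2]

variable {Ω : Type*} [MeasurableSpace Ω] {μ : Measure Ω} [IsProbabilityMeasure μ]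
  {T Y : ℕ → Ω → ℝ} {P Q : Measure ℝ}

theorem CensoredModel.integral_integral_empCDF (h : CensoredModel μ T Y P Q)
    {D : Set (ℝ × ℝ)} {V : ℝ × ℝ → ℝ} (hV : Measurable V) (hD : MeasurableSet D) {ψ : ℝ → ℝ}
    (hψ : Measurable ψ) {M : ℝ} (hM : ∀ x, |ψ x| ≤ M) {n : ℕ} (hn : 0 < n) :
    ∫ ω, ∫ y, ψ y ∂(empCDF n (fun i => V (T i ω, Y i ω))
      fun i => (T i ω, Y i ω) ∈ D).measure ∂μ = ∫ y, ψ y ∂(subLaw P Q D V) := by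
  classical
  have := h.isProbabilityMeasure_left
  have := h.isProbabilityMeasure_right
  have hn' : (n : ℝ) ≠ 0 := by positivity
  set H : ℝ × ℝ → ℝ := D.indicator fun z => ψ (V z) with hH
  have hHm : Measurable H := (hψ.comp hV).indicator hD
  have hpair : ∀ i, Measurable fun ω => (T i ω, Y i ω) := fun i =>
    (h.measurable_T i).prodMk (h.measurable_Y i)
  have hint : ∀ i, ∫ ω, H (T i ω, Y i ω) ∂μ = ∫ y, ψ y ∂(subLaw P Q D V) := fun i => by
    rw [← integral_map (hpair i).aemeasurable hHm.aestronglyMeasurable, h.law_pair, subLaw,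
      integral_map hV.aemeasurable hψ.aestronglyMeasurable, integral_indicator hD]
  have heq : ∀ ω, ∫ y, ψ y ∂(empCDF n (fun i => V (T i ω, Y i ω))
      fun i => (T i ω, Y i ω) ∈ D).measure =
      1 / n * ∑ i ∈ Finset.range n, H (T i ω, Y i ω) := fun ω => by
    rw [integral_empCDF, Finset.sum_filter]
    congr 1
  simp only [heq]
  rw [integral_const_mul, integral_finsetSum]
  · simp only [hint, Finset.sum_const, Finset.card_range, nsmul_eq_mul]
    field_simp
  · exact fun i _ => Integrable.of_bound (hHm.comp (hpair i)).aestronglyMeasurable M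
      (Eventually.of_forall fun ω => (norm_indicator_le_norm_self _ _).trans (hM _))

theorem abs_kernelSmooth_sub_kernelSmooth_le {k : ℝ → ℝ} {a b t C : ℝ} (hb : 0 < b)
    {H : StieltjesFunction ℝ} {ν : Measure ℝ}
    (h : |∫ x in Ici a, k ((t - x) / b) ∂H.measure - ∫ x in Ici a, k ((t - x) / b) ∂ν| ≤ C) :
    |kernelSmooth k b a H t - b⁻¹ * ∫ x in Ici a, k ((t - x) / b) ∂ν| ≤ b⁻¹ * C := by
  rw [kernelSmooth, ← mul_sub, abs_mul, abs_of_pos (inv_pos.2 hb)]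
  exact mul_le_mul_of_nonneg_left h (inv_pos.2 hb).le

/-- The kernel smoother of a subsample is within `b⁻¹ (log n / n)^{1/2}` of its mean, uniformly. -/
theorem CensoredModel.exists_ae_eventually_kernelSmooth_empCDF (h : CensoredModel μ T Y P Q)
    {k : ℝ → ℝ} {r s : ℝ} (hr : r < 0) (hs : 0 < s) (hk : IsBVKernel k r s)
    {b : ℕ → ℝ} (hb : ∀ n, 1 ≤ n → 0 < b n) (a : ℝ) {D : Set (ℝ × ℝ)} {V : ℝ × ℝ → ℝ}
    (hV : Measurable V) (hD : BiMonotoneSet D)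
    (hVD : ∀ A, IsLowerSet A → BiMonotoneSet (V ⁻¹' A ∩ D)) :
    ∃ K, 0 ≤ K ∧ ∀ᵐ ω ∂μ, ∀ᶠ n : ℕ in atTop, ∀ t,
      |kernelSmooth k (b n) a (empCDF n (fun i => V (T i ω, Y i ω))
          fun i => (T i ω, Y i ω) ∈ D) t -
        ∫ ω', kernelSmooth k (b n) a (empCDF n (fun i => V (T i ω', Y i ω'))
          fun i => (T i ω', Y i ω') ∈ D) t ∂μ| ≤ K * ((b n)⁻¹ * rate n) := by
  have := h.isProbabilityMeasure_left
  have := h.isProbabilityMeasure_right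
  obtain ⟨K, hK0, hK⟩ := hk.exists_abs_integral_sub_le hr hs
  obtain ⟨M, hM⟩ := hk.exists_bound hr hs
  have hkm := hk.measurable hr hs
  refine ⟨K * 3, by positivity, ?_⟩
  filter_upwards [h.ae_eventually_uniform hV hD (fun x => hVD _ (isLowerSet_Iic x))
    fun x => hVD _ (isLowerSet_Iio x)] with ω hω
  filter_upwards [hω, eventually_ge_atTop 1] with n hω hn t
  have hE : ∫ ω', kernelSmooth k (b n) a (empCDF n (fun i => V (T i ω', Y i ω'))
      fun i => (T i ω', Y i ω') ∈ D) t ∂μ =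
      (b n)⁻¹ * ∫ x in Ici a, k ((t - x) / b n) ∂(subLaw P Q D V) := by
    have hψm : Measurable ((Ici a).indicator fun x => k ((t - x) / b n)) :=
      (hkm.comp (by fun_prop)).indicator measurableSet_Ici
    have := h.integral_integral_empCDF hV hD.measurableSet hψm (M := M)
      (fun x => (norm_indicator_le_norm_self (fun x => k ((t - x) / b n)) x).trans (hM _))
      (n := n) hn
    simp only [integral_indicator measurableSet_Ici] at this
    simp only [kernelSmooth]
    rw [integral_const_mul, this]
  rw [hE]
  refine (abs_kernelSmooth_sub_kernelSmooth_le (hb n hn)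
    (hK _ _ (t - r * b n) (3 * rate n) (mul_nonneg (by norm_num) (rate_nonneg n))
      (fun x _ => ?_) a (b n) t (hb n hn) le_rfl)).trans_eq (by ring)
  rw [← freq_eq_real_empCDF V D measurableSet_Iic]
  exact hω x

theorem tendsto_kmCDF_atBot (n : ℕ) (x : ℕ → ℝ) (δ : ℕ → Prop) :
    Tendsto (kmCDF n x δ) atBot (𝓝 0) := by
  classical
  refine tendsto_const_nhds.congr' ?_
  have : ∀ᶠ t in atBot, ∀ s ∈ (Finset.range n).image x, t < s :=
    (Filter.eventually_all_finset _).2 fun s _ => eventually_lt_atBot s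
  filter_upwards [this] with t ht
  change 0 = 1 - kmSurv n x δ t
  rw [kmSurv, Finset.prod_eq_one, sub_self]
  intro s hs
  rw [Finset.mem_filter] at hs
  exact absurd (ht s hs.1) (not_lt.2 hs.2)

theorem tendsto_kmCDF_atTop (n : ℕ) (x : ℕ → ℝ) (δ : ℕ → Prop) :
    ∃ l, Tendsto (kmCDF n x δ) atTop (𝓝 l) := by
  rcases tendsto_atTop_of_monotone (kmCDF n x δ).mono with h | h
  · exfalso
    obtain ⟨t, ht⟩ := (h.eventually_gt_atTop 1).exists
    have : kmCDF n x δ t = 1 - kmSurv n x δ t := rfl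
    have h2 : 0 ≤ kmSurv n x δ t := Finset.prod_nonneg fun s _ => (kmFactor_mem n x δ s).1
    linarith
  · exact h

instance (n : ℕ) (x : ℕ → ℝ) (δ : ℕ → Prop) : IsFiniteMeasure (kmCDF n x δ).measure := by
  obtain ⟨l, hl⟩ := tendsto_kmCDF_atTop n x δ
  exact ⟨by
    rw [StieltjesFunction.measure_univ _ (tendsto_kmCDF_atBot n x δ) hl]
    exact ENNReal.ofReal_lt_top⟩

theorem real_kmCDF_Iic (n : ℕ) (x : ℕ → ℝ) (δ : ℕ → Prop) (t : ℝ) :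
    (kmCDF n x δ).measure.real (Iic t) = 1 - kmSurv n x δ t := by
  have h1 : kmSurv n x δ t ≤ 1 := Finset.prod_le_one (fun s _ => (kmFactor_mem n x δ s).1)
    fun s _ => (kmFactor_mem n x δ s).2
  rw [measureReal_def, StieltjesFunction.measure_Iic _ (tendsto_kmCDF_atBot n x δ), sub_zero]
  exact ENNReal.toReal_ofReal (sub_nonneg.2 h1)

/-- The smoothed Kaplan-Meier estimator is within `b⁻¹ (log n / n)^{1/2}` of the smoothed lifetime
law, uniformly. -/
theorem CensoredModel.exists_ae_eventually_kernelSmooth_kmCDF [NullSingletonClass P]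
    (h : CensoredModel μ T Y P Q) {k : ℝ → ℝ} {r s : ℝ} (hr : r < 0) (hs : 0 < s)
    (hk : IsBVKernel k r s) {b : ℕ → ℝ} (hb : ∀ n, 1 ≤ n → 0 < b n)
    (hb0 : Tendsto b atTop (𝓝 0)) (a : ℝ) {τ c : ℝ} (hτc : τ < c)
    (hc : 0 < P.real (Ioi c) * Q.real (Ioi c)) :
    ∃ K, 0 ≤ K ∧ ∀ᵐ ω ∂μ, ∀ᶠ n : ℕ in atTop, ∀ t ≤ τ,
      |kernelSmooth k (b n) a
          (kmCDF n (fun i => obs T Y i ω) fun i => uncensored T Y i ω) t -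
        (b n)⁻¹ * ∫ x in Ici a, k ((t - x) / b n) ∂P| ≤ K * ((b n)⁻¹ * rate n) := by
  have := h.isProbabilityMeasure_left
  have := h.isProbabilityMeasure_right
  obtain ⟨K, hK0, hK⟩ := hk.exists_abs_integral_sub_le hr hs
  set a₀ := P.real (Ioi c) * Q.real (Ioi c) with ha₀
  refine ⟨K * (12 / a₀ ^ 2 * 3), by positivity, ?_⟩
  have hrate : ∀ᶠ n in atTop, 3 * rate n ≤ a₀ / 2 := by
    have := tendsto_rate.const_mul 3
    rw [mul_zero] at this
    exact this.eventually_le_const (by positivity)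
  -- The kernel window at `t` extends to `t - r * b n > t`. As `b n → 0`, it eventually stays below
  -- `c`, where the Kaplan-Meier bound is available.
  have hbc : ∀ᶠ n in atTop, τ - r * b n ≤ c := by
    have := (hb0.const_mul r).const_sub τ
    rw [mul_zero, sub_zero] at this
    exact this.eventually_le_const hτc
  filter_upwards [h.ae_eventually_uniform measurable_minPair biMonotoneSet_uncensored
      (fun x => biMonotoneSet_minPair_preimage_uncensored (isLowerSet_Iic x))
      (fun x => biMonotoneSet_minPair_preimage_uncensored (isLowerSet_Iio x)),
    h.ae_eventually_uniform measurable_minPair biMonotoneSet_univ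
      (fun x => biMonotoneSet_minPair_preimage (isLowerSet_Iic x))
      (fun x => biMonotoneSet_minPair_preimage (isLowerSet_Iio x))] with ω hN hX
  filter_upwards [hN, hX, hrate, hbc, eventually_ge_atTop 1] with n hN hX hrate hbc hn t ht
  have hε : 0 ≤ 3 * rate n := mul_nonneg (by norm_num) (rate_nonneg n)
  simp only [freq_eq_real_empCDF _ _ measurableSet_Iic] at hN hX
  refine (abs_kernelSmooth_sub_kernelSmooth_le (hb n hn)
    (hK _ _ c (12 / a₀ ^ 2 * (3 * rate n)) (by positivity)
      (fun x hx => ?_) a (b n) t (hb n hn) (by linarith))).trans_eq (by ring)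
  have hmain := abs_kmSurv_sub_le (P := P) (Q := Q) hc le_rfl hn hε hrate hN hX hx
  have hIic : P.real (Iic x) = 1 - P.real (Ioi x) := by
    rw [← compl_Ioi, probReal_compl_eq_one_sub measurableSet_Ioi]
  rw [real_kmCDF_Iic, hIic, sub_sub_sub_cancel_left, abs_sub_comm]
  exact hmain

end Smoothing

/-! ### Distribution functions and laws -/

section Laws

theorem map_real_Iic {Ω : Type*} [MeasurableSpace Ω] {μ : Measure Ω} {Z : Ω → ℝ} (hZ : Measurable Z) {H : ℝ → ℝ}
    (hH : ∀ x, μ.real {ω | Z ω ≤ x} = H x) (x : ℝ) : (μ.map Z).real (Iic x) = H x := by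
  rw [map_measureReal_apply hZ measurableSet_Iic, ← hH]
  rfl

theorem measure_eq_of_real_Iic {P : Measure ℝ} [IsProbabilityMeasure P] {H : StieltjesFunction ℝ}
    (hH : ∀ x, P.real (Iic x) = H x) : H.measure = P := by
  have : H = cdf P := by
    ext x
    rw [cdf_eq_real, hH]
  rw [this, measure_cdf]

theorem law_eq_of_real_Iic {P : Measure ℝ} [IsProbabilityMeasure P] {P' : Measure ℝ}
    [IsProbabilityMeasure P'] (h : ∀ x, P.real (Iic x) = P'.real (Iic x)) : P = P' :=
  Measure.ext_of_Iic _ _ fun x => by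
    rw [← ofReal_measureReal, h x, ofReal_measureReal]

theorem nullSingletonClass_of_continuous {H : StieltjesFunction ℝ} (hH : Continuous H) :
    NullSingletonClass H.measure := by
  refine ⟨fun x => ?_⟩
  rw [StieltjesFunction.measure_singleton,
    hH.continuousAt.continuousWithinAt.leftLim_eq, sub_self, ENNReal.ofReal_zero]

end Laws

end CensoredNA

/-! ### Combining the two smoothing bounds -/

theorem theorem1 {Ω : Type*} [MeasurableSpace Ω] (μ : Measure Ω) [IsProbabilityMeasure μ]
    (T Y : ℕ → Ω → ℝ)
    (hTmeas : ∀ i, Measurable (T i)) (hYmeas : ∀ i, Measurable (Y i))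
    (hTnonneg : ∀ i ω, 0 ≤ T i ω) (hYnonneg : ∀ i ω, 0 ≤ Y i ω)
    (hTNA : CensoredNA.NegAssociated μ T) (hYNA : CensoredNA.NegAssociated μ Y)
    (hindep : IndepFun (fun ω i => T i ω) (fun ω i => Y i ω) μ)
    (F G : StieltjesFunction ℝ)
    (hF : ∀ i x, μ.real {ω | T i ω ≤ x} = F x) (hG : ∀ i x, μ.real {ω | Y i ω ≤ x} = G x)
    (hFcont : Continuous F)
    (k : ℝ → ℝ) (r s : ℝ) (hr : r < 0) (hs : 0 < s) (hk : CensoredNA.IsBVKernel k r s)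
    (τ : ℝ) (haτ : CensoredNA.leftEndpoint F < τ)
    (hτL : (τ : EReal) <
      CensoredNA.rightEndpoint (fun x => μ.real {ω | CensoredNA.obs T Y 0 ω ≤ x}))
    (f g : ℝ → ℝ) (hf : CensoredNA.HasBoundedDensityOn F f τ)
    (hg : CensoredNA.HasBoundedDensityOn G g τ)
    (b : ℕ → ℝ) (hbpos : ∀ n, 1 ≤ n → 0 < b n) (hb0 : Tendsto b atTop (𝓝 0))
    (hb : (fun n : ℕ => (b n)⁻¹) =o[atTop] fun n : ℕ => Real.sqrt ((n : ℝ) / Real.log n)) :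
    (∀ᵐ ω ∂μ, ∃ C : ℝ, ∀ᶠ n : ℕ in atTop, ∀ t ∈ Ioc (0 : ℝ) τ,
      |CensoredNA.fHat k b F T Y n t ω - CensoredNA.fBar k b F n t
          - (CensoredNA.fStar k b F T Y n t ω - ∫ ω', CensoredNA.fStar k b F T Y n t ω' ∂μ)
            / (1 - G t)|
        ≤ C * ((b n)⁻¹ * Real.sqrt (Real.log n / n))) ∧
    (∀ᵐ ω ∂μ, ∃ C : ℝ, ∀ᶠ n : ℕ in atTop, ∀ t ∈ Ioc (0 : ℝ) τ,
      |CensoredNA.fHat k b F T Y n t ω - CensoredNA.fBar k b F n t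
          - (CensoredNA.fStarLife k b F T n t ω - ∫ ω', CensoredNA.fStarLife k b F T n t ω' ∂μ)
            / (1 - G t)|
        ≤ C * ((b n)⁻¹ * Real.sqrt (Real.log n / n))) := by
  set P := μ.map (T 0) with hP
  set Q := μ.map (Y 0) with hQ
  have hPp : IsProbabilityMeasure P := Measure.isProbabilityMeasure_map (hTmeas 0).aemeasurable
  have hQp : IsProbabilityMeasure Q := Measure.isProbabilityMeasure_map (hYmeas 0).aemeasurable
  have hPF : ∀ x, P.real (Iic x) = F x :=
    CensoredNA.map_real_Iic (hTmeas 0) (hF 0)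
  have hQG : ∀ x, Q.real (Iic x) = G x :=
    CensoredNA.map_real_Iic (hYmeas 0) (hG 0)
  have hFP : F.measure = P := CensoredNA.measure_eq_of_real_Iic hPF
  have hPnull : NullSingletonClass P := hFP ▸ CensoredNA.nullSingletonClass_of_continuous hFcont
  have hmodel : CensoredNA.CensoredModel μ T Y P Q :=
    { measurable_T := hTmeas
      measurable_Y := hYmeas
      negAssociated_T := hTNA
      negAssociated_Y := hYNA
      indep := hindep
      law_T := fun i => by
        have := Measure.isProbabilityMeasure_map (μ := μ) (hTmeas i).aemeasurable
        exact CensoredNA.law_eq_of_real_Iic fun x => by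
          rw [CensoredNA.map_real_Iic (hTmeas i) (hF i), hPF]
      law_Y := fun i => by
        have := Measure.isProbabilityMeasure_map (μ := μ) (hYmeas i).aemeasurable
        exact CensoredNA.law_eq_of_real_Iic fun x => by
          rw [CensoredNA.map_real_Iic (hYmeas i) (hG i), hQG] }
  -- Choose `c > τ` at which the law of the observations still has mass to the right. By
  -- independence, that mass is the product of the two survival probabilities at `c`; it bounds both
  -- the at-risk probability and `1 - G t` from below.
  obtain ⟨_, ⟨c, hc, rfl⟩, hτc⟩ := lt_sSup_iff.1 hτL
  have hτc' : τ < c := EReal.coe_lt_coe_iff.1 hτc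
  have hpos : 0 < P.real (Ioi c) * Q.real (Ioi c) := by
    have h1 : μ.real {ω | CensoredNA.obs T Y 0 ω ≤ c} =
        1 - P.real (Ioi c) * Q.real (Ioi c) := by
      rw [← CensoredNA.prod_real_Ioi_minPair, ← hmodel.law_pair 0,
        map_measureReal_apply ((hTmeas 0).prodMk (hYmeas 0))
          (CensoredNA.measurable_minPair measurableSet_Ioi),
        ← probReal_compl_eq_one_sub (((hTmeas 0).prodMk (hYmeas 0))
          (CensoredNA.measurable_minPair measurableSet_Ioi))]
      congr 1
      ext ω
      exact (not_lt (a := c) (b := min (T 0 ω) (Y 0 ω))).symm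
    have h2 : μ.real {ω | CensoredNA.obs T Y 0 ω ≤ c} < 1 := hc
    linarith
  set a₀ := P.real (Ioi c) * Q.real (Ioi c) with ha₀
  have hGt : ∀ t ≤ τ, a₀ ≤ 1 - G t := fun t ht => by
    rw [← hQG, ← probReal_compl_eq_one_sub measurableSet_Iic, compl_Iic]
    exact (mul_le_of_le_one_left measureReal_nonneg measureReal_le_one).trans
      (measureReal_mono (Ioi_subset_Ioi (ht.trans hτc'.le)))
  obtain ⟨K₁, hK₁, hkm⟩ := hmodel.exists_ae_eventually_kernelSmooth_kmCDF hr hs hk hbpos hb0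
    (CensoredNA.leftEndpoint F) hτc' hpos
  have hcomb : ∀ {x y u R K₂ : ℝ}, a₀ ≤ u → |x| ≤ K₁ * R → |y| ≤ K₂ * R →
      |x - y / u| ≤ (K₁ + K₂ / a₀) * R := fun {x y u R K₂} hu hx hy => by
    have hu0 : 0 < u := hpos.trans_le hu
    have h1 : |y / u| ≤ K₂ * R / a₀ := by
      rw [abs_div, abs_of_pos hu0]
      exact div_le_div₀ ((abs_nonneg _).trans hy) hy hpos hu
    calc |x - y / u| ≤ |x| + |y / u| := abs_sub _ _
      _ ≤ K₁ * R + K₂ * R / a₀ := add_le_add hx h1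
      _ = (K₁ + K₂ / a₀) * R := by ring
  have hbar : ∀ n t, CensoredNA.fBar k b F n t =
      (b n)⁻¹ * ∫ x in Ici (CensoredNA.leftEndpoint F), k ((t - x) / b n) ∂P := fun n t => by
    rw [CensoredNA.fBar, CensoredNA.kernelSmooth, hFP]
  constructor
  · obtain ⟨K₂, hK₂, hst⟩ := hmodel.exists_ae_eventually_kernelSmooth_empCDF hr hs hk hbpos
      (CensoredNA.leftEndpoint F) CensoredNA.measurable_minPair
      CensoredNA.biMonotoneSet_uncensored
      fun A hA => CensoredNA.biMonotoneSet_minPair_preimage_uncensored hA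
    filter_upwards [hkm, hst] with ω hkm hst
    refine ⟨K₁ + K₂ / a₀, ?_⟩
    filter_upwards [hkm, hst] with n hkm hst t ht
    rw [hbar]
    exact hcomb (hGt t ht.2) (hkm t ht.2) (hst t)
  · obtain ⟨K₂, hK₂, hst⟩ := hmodel.exists_ae_eventually_kernelSmooth_empCDF hr hs hk hbpos
      (CensoredNA.leftEndpoint F) measurable_fst CensoredNA.biMonotoneSet_univ
      fun A hA => CensoredNA.biMonotoneSet_fst_preimage hA
    filter_upwards [hkm, hst] with ω hkm hst
    refine ⟨K₁ + K₂ / a₀, ?_⟩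
    filter_upwards [hkm, hst] with n hkm hst t ht
    rw [hbar]
    exact hcomb (hGt t ht.2) (hkm t ht.2) (hst t)
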